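/- Let $K$ be a field of characteristic zero and let $K[\mathbb P^3]=K[x_0,x_1,x_2,x_3]$ with the standard grading. For a homogeneous ideal $I$ let $I^{(m)}=K[\mathbb P^3]\cap\bigcap_{\mathfrak p\in\mathrm{Ass}(I)}I^mK[\mathbb P^3]_{\mathfrak p}$ be its $m$-th symbolic power, let $\alpha(I)$ be the least degree of a nonzero form in $I$, and let $\gamma(I)=\lim_{m\to\infty}\alpha(I^{(m)})/m$ be its Waldschmidt constant. Let $\gamma(n)$ be the Waldschmidt constant $\gamma(I)$ of the ideal $I$ of $n$ simple points in general position in $\mathbb P^3$. That is, for each $m$ the number $\alpha(I^{(m)})$ takes one and the same value $a_m$ for all $n$-tuples of $K$-points in some nonempty Zariski-open subset of $(\mathbb P^3)^n$ (which may depend on $m$), and $\gamma(n)=\lim_{m\to\infty}a_m/m$; equivalently, $\gamma(n)=\gamma(I)$ for the ideal $I$ of the $n$ generic points $(x_{i0}:x_{i1}:x_{i2}:x_{i3})$, $1\le i\le n$, over the field $K(x_{ij})$ of rational functions in independent indeterminates. Then $\gamma(n)$ exists in both senses, with the same value, and $\gamma(n)\ge b(n)$ for all $n$ in the following table: $$ \begin{array}{c|cccccccccccccccc}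 n & 1 & 2 & 3 & 4 & 5 & 6 & 7 & 8 & 12 & 14 & 16 & 17 & 21 & 24 & 30 & 35 \\ \hline b(n) & 1 & 1 & 1 & \frac{4}{3} & \frac{5}{3} & \frac{12}{7} & \frac{28}{15} & 2 & \frac{126}{57} & \frac{7}{3} & \frac{22}{9} & \frac{5}{2} & \frac{8}{3} & \frac{107}{39} & 3 & \frac{67}{21} \end{array} $$ -/

import Mathlib

open Filter Topology

noncomputable section

namespace FatPoints

/-- The homogeneous coordinate ring `K[x₀, …, x_N]` of `ℙ^N`. -/
abbrev Coord (K : Type*) [Field K] (N : ℕ) : Type _ := MvPolynomial (Fin (N + 1)) K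

/-- The `K`-points of `ℙ^N`. -/
abbrev Pt (K : Type*) [Field K] (N : ℕ) : Type _ := Projectivization K (Fin (N + 1) → K)

section

variable {K : Type*} [Field K] {N n : ℕ}

/-- `α(I)`: the least degree of a nonzero form in `I`
(the value for the zero ideal is irrelevant and equals `0`). -/
def alpha (I : Ideal (Coord K N)) : ℕ :=
  sInf {t : ℕ | ∃ f ∈ I, f ≠ 0 ∧ f.IsHomogeneous t}

/-- The symbolic power `I^(m) = R ∩ ⋂_{𝔭 ∈ Ass(I)} I^m R_𝔭` of an ideal `I` of a ring `R`, where
`Ass(I)` is the set of associated primes of the `R`-module `R / I`. -/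
def symbolicPower {R : Type*} [CommRing R] (I : Ideal R) (m : ℕ) : Ideal R :=
  ⨅ (p : Ideal R) (hp : p ∈ associatedPrimes R (R ⧸ I)),
    haveI : p.IsPrime := hp.1
    ((I ^ m).map (algebraMap R (Localization.AtPrime p))).comap
      (algebraMap R (Localization.AtPrime p))

/-- `g` is the Waldschmidt constant `γ(I) = lim α(I^(m)) / m`: the limit exists and equals `g`. -/
def HasWaldschmidtConstant (I : Ideal (Coord K N)) (g : ℝ) : Prop :=
  Tendsto (fun m : ℕ => (alpha (symbolicPower I m) : ℝ) / (m : ℝ)) atTop (𝓝 g)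

/-- The ideal `𝔪_p` generated by the forms vanishing at the point `p`. For a form, vanishing
does not depend on the chosen vector of homogeneous coordinates of `p`. -/
def pointIdeal (p : Pt K N) : Ideal (Coord K N) :=
  Ideal.span {f | (∃ d : ℕ, f.IsHomogeneous d) ∧ MvPolynomial.eval p.rep f = 0}

/-- The ideal of the simple points `p₁, …, p_n`. -/
def pointsIdeal (p : Fin n → Pt K N) : Ideal (Coord K N) :=
  ⨅ i, pointIdeal (p i)

/-- The property `P` holds for `n` points of `ℙ^N` in general position, that is, on some nonempty
Zariski-open subset of `(ℙ^N)^n`: there is a nonzero polynomial `F` in the homogeneous coordinates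
of the `n` points such that `P` holds for all `n`-tuples that have homogeneous coordinates at which
`F` does not vanish. -/
def ForGeneralPoints (P : (Fin n → Pt K N) → Prop) : Prop :=
  ∃ F : MvPolynomial (Fin n × Fin (N + 1)) K, F ≠ 0 ∧
    ∀ (v : Fin n → Fin (N + 1) → K) (hv : ∀ i, v i ≠ 0),
      MvPolynomial.eval (fun ij => v ij.1 ij.2) F ≠ 0 →
        P (fun i => Projectivization.mk K (v i) (hv i))

end

section

variable (K : Type*) [Field K] (N n : ℕ)

/-- `g` is the Waldschmidt constant of `n` simple points of `ℙ^N` over `K` in general position: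
for every `m` the number `α(I^(m))` has the same value `a m` for all ideals `I` of `n` points in
general position (the open set may depend on `m`), and `a m / m` tends to `g`. In particular
`γ(I) = g` whenever the points lie in all these open sets. -/
def IsGeneralWaldschmidtConstant (g : ℝ) : Prop :=
  ∃ a : ℕ → ℕ,
    (∀ m : ℕ, ForGeneralPoints
      (fun p : Fin n → Pt K N => alpha (symbolicPower (pointsIdeal p) m) = a m)) ∧
    Tendsto (fun m : ℕ => (a m : ℝ) / (m : ℝ)) atTop (𝓝 g)

/-- The field `K(x_{ij})` of rational functions in the homogeneous coordinates of `n` points. -/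
abbrev GenericField : Type _ := FractionRing (MvPolynomial (Fin n × Fin (N + 1)) K)

/-- The vector of homogeneous coordinates of the `i`-th generic point. -/
def genericVec (i : Fin n) : Fin (N + 1) → GenericField K N n :=
  fun j => algebraMap (MvPolynomial (Fin n × Fin (N + 1)) K) (GenericField K N n)
    (MvPolynomial.X (i, j))

theorem genericVec_ne_zero (i : Fin n) : genericVec K N n i ≠ 0 := by
  intro h
  have h0 := congrFun h 0
  simp only [genericVec, Pi.zero_apply] at h0
  exact MvPolynomial.X_ne_zero (R := K) (i, (0 : Fin (N + 1)))
    ((IsFractionRing.to_map_eq_zero_iff (K := GenericField K N n)).1 h0)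

/-- The `n` generic points of `ℙ^N`: the `i`-th one is `(x_{i0} : … : x_{iN})`, with independent
indeterminates `x_{ij}` over `K`. -/
def genericPoints : Fin n → Pt (GenericField K N n) N :=
  fun i => Projectivization.mk _ (genericVec K N n i) (genericVec_ne_zero K N n i)

end

/-- The table of lower bounds; `none` where no bound is listed. -/
def b : ℕ → Option ℚ
  | 1 => some 1
  | 2 => some 1
  | 3 => some 1
  | 4 => some (4 / 3)
  | 5 => some (5 / 3)
  | 6 => some (12 / 7)
  | 7 => some (28 / 15)
  | 8 => some 2
  | 12 => some (126 / 57)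
  | 14 => some (7 / 3)
  | 16 => some (22 / 9)
  | 17 => some (5 / 2)
  | 21 => some (8 / 3)
  | 24 => some (107 / 39)
  | 30 => some 3
  | 35 => some (67 / 21)
  | _ => none

end FatPoints

end

/-! Multiplicity conditions at points are linear in the coefficients of a form (`hasForm_iff`), so
the absence of forms is an open condition: a form for the generic points specializes to every tuple,
and if the generic points have no form of degree t, then neither do the tuples off some
hypersurface. For forms, membership in the m-th symbolic power means multiplicity at least m at
every point (`mem_symbolicPower_pointsIdeal_iff`). Hence the least degree a_m at the generic points
is also the value at general points. Products of forms make a_m subadditive, and Fekete's lemma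
gives the common limit.

It remains to bound d below when every n-tuple carries a form of degree d with multiplicity m at
each point. Two operations preserve this property. The Cremona transformation x_i ↦ 1/x_i
(`Effective.cremona_sum`) adds 2d minus the sum of four multiplicities to the degree and to those
four multiplicities. Collision of points (`Effective.glue_sum`) replaces a group of points by one
point of multiplicity k + 1, provided that degree k is too small for the group. A bound for few
points thus feeds into a bound for many: eight points of multiplicity m merge into one of
multiplicity 2m, five of multiplicity 3m into one of multiplicity 5m.

After merging, a chain of Cremona transformations leads to an inequality: the degree is nonnegative,
or it is at least one of the multiplicities, or it satisfies an inequality for eight points or for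
one point and nine others. These last inequalities (`EffectiveM.sum_le_of_card_eq_eight`,
`EffectiveM.sum_le_of_card_eq_nine`) come from infinite Cremona sequences, along which the degree
would decrease quadratically, and from averaging over cyclic rotations. -/

noncomputable section

namespace FatPoints

open MvPolynomial

/-! ### Multiplicity of a polynomial at a point -/

section Multiplicity

variable {σ A B : Type*} [CommRing A] [CommRing B]

/-- The substitution `f(x) ↦ f(x + v)`. -/
def translate (v : σ → A) : MvPolynomial σ A →ₐ[A] MvPolynomial σ A :=
  aeval fun i => X i + C (v i)

/-- `f` has multiplicity at least `m` at the point `v` of affine space. -/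
def HasMult (m : ℕ) (v : σ → A) (f : MvPolynomial σ A) : Prop :=
  translate v f ∈ idealOfVars σ A ^ m

variable {m k : ℕ} {v : σ → A} {f g : MvPolynomial σ A}

theorem hasMult_iff_coeff :
    HasMult m v f ↔ ∀ b : σ →₀ ℕ, b.degree < m → (translate v f).coeff b = 0 :=
  mem_pow_idealOfVars_iff' _ _

theorem HasMult.mono (h : HasMult m v f) (hk : k ≤ m) : HasMult k v f :=
  Ideal.pow_le_pow_right hk h

theorem HasMult.mul (hf : HasMult m v f) (hg : HasMult k v g) : HasMult (m + k) v (f * g) := by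
  rw [HasMult, map_mul, pow_add]
  exact Ideal.mul_mem_mul hf hg

theorem HasMult.mul_left (hf : HasMult m v f) (g : MvPolynomial σ A) : HasMult m v (g * f) := by
  rw [HasMult, map_mul]
  exact Ideal.mul_mem_left _ _ hf

theorem hasMult_zero_left : HasMult 0 v f := by
  simp [HasMult]

theorem HasMult.pow (hf : HasMult m v f) (n : ℕ) : HasMult (n * m) v (f ^ n) := by
  induction n with
  | zero => simpa using hasMult_zero_left
  | succ n ih => rw [pow_succ, Nat.succ_mul]; exact ih.mul hf

theorem HasMult.sum {ι : Type*} (s : Finset ι) {F : ι → MvPolynomial σ A}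
    (h : ∀ i ∈ s, HasMult m v (F i)) : HasMult m v (∑ i ∈ s, F i) := by
  rw [HasMult, map_sum]
  exact Ideal.sum_mem _ h

/-- Taylor expansion at `v`: every surviving term is a product of at least `m` of the differences `a
i - v i`. Because `B` is arbitrary, this also serves for quotients and localizations. -/
theorem HasMult.aeval_mem [Algebra A B] (h : HasMult m v f) (J : Ideal B) (a : σ → B)
    (ha : ∀ i, a i - algebraMap A B (v i) ∈ J) : aeval a f ∈ J ^ m := by
  have key : aeval a f = aeval (fun i => a i - algebraMap A B (v i)) (translate v f) := by
    rw [translate, ← AlgHom.comp_apply, comp_aeval]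
    simp
  rw [key]
  have h1 : (idealOfVars σ A).map (aeval (R := A) fun i => a i - algebraMap A B (v i)) ≤ J := by
    rw [Ideal.map_span, Ideal.span_le]
    rintro _ ⟨_, ⟨i, rfl⟩, rfl⟩
    simpa using ha i
  have h2 := Ideal.mem_map_of_mem (aeval (R := A) fun i => a i - algebraMap A B (v i)) h
  rw [Ideal.map_pow] at h2
  exact Ideal.pow_right_mono h1 m h2

theorem constantCoeff_translate (g : MvPolynomial σ A) :
    constantCoeff (translate v g) = eval v g := by
  induction g using MvPolynomial.induction_on with
  | C a => simp [translate]
  | add p q hp hq => simp [hp, hq]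
  | mul_X p i hp => simp [hp]; simp [translate]

theorem hasMult_of_mem_pow {I : Ideal (MvPolynomial σ A)} (hI : ∀ g ∈ I, eval v g = 0)
    (hf : f ∈ I ^ m) : HasMult m v f := by
  have h1 : I.map (translate v) ≤ idealOfVars σ A := by
    rw [Ideal.map_le_iff_le_comap]
    intro g hg
    have : translate v g ∈ idealOfVars σ A ^ 1 := by
      rw [mem_pow_idealOfVars_iff']
      intro x hx
      have hx : x = 0 := (Finsupp.degree_eq_zero_iff x).1 (by omega)
      rw [hx, ← constantCoeff_eq, constantCoeff_translate, hI g hg]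
    simpa using this
  have h2 := Ideal.mem_map_of_mem (translate v) hf
  rw [Ideal.map_pow] at h2
  exact Ideal.pow_right_mono h1 m h2

theorem HasMult.comp {τ : Type*} {L : σ → MvPolynomial τ A} {w : τ → A}
    (h : HasMult m (fun i => eval w (L i)) f) : HasMult m w (aeval L f) := by
  refine hasMult_of_mem_pow (I := RingHom.ker (eval w)) (fun g hg => hg) (h.aeval_mem _ _ ?_)
  intro i
  simp [RingHom.mem_ker]

theorem translate_map (φ : A →+* B) (v : σ → A) (f : MvPolynomial σ A) :
    translate (φ ∘ v) (map φ f) = map φ (translate v f) := by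
  induction f using MvPolynomial.induction_on with
  | C a => simp [translate]
  | add p q hp hq => simp [hp, hq]
  | mul_X p i hp => simp [hp]; simp [translate]

theorem HasMult.map (h : HasMult m v f) (φ : A →+* B) : HasMult m (φ ∘ v) (map φ f) := by
  rw [hasMult_iff_coeff] at h ⊢
  intro b hb
  rw [translate_map, coeff_map, h b hb, map_zero]

theorem aeval_mul_of_isHomogeneous [Algebra A B] {d : ℕ} (hf : f.IsHomogeneous d) (c : B)
    (y : σ → B) : aeval (fun i => c * y i) f = c ^ d * aeval y f := by
  conv_lhs => rw [f.as_sum]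
  conv_rhs => rw [f.as_sum]
  rw [map_sum, map_sum, Finset.mul_sum]
  refine Finset.sum_congr rfl fun e he => ?_
  rw [aeval_monomial, aeval_monomial, hf.degree_eq_sum_deg_support he, Finsupp.prod, Finsupp.prod]
  simp only [mul_pow, Finset.prod_mul_distrib]
  rw [Finset.prod_pow_eq_pow_sum]
  ring

theorem eq_zero_of_hasMult_zero {d : ℕ} (hf : f.IsHomogeneous d) (hd : d < m)
    (h : HasMult m 0 f) : f = 0 := by
  have h1 : translate (0 : σ → A) f = f := by simp [translate]
  rw [hasMult_iff_coeff, h1] at h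
  ext b
  by_cases hb : b.degree = d
  · simpa using h b (by omega)
  · simpa using hf.coeff_eq_zero hb

theorem hasMult_smul_iff {F : Type*} [Field F] {d : ℕ} {v : σ → F} {f : MvPolynomial σ F}
    (hf : f.IsHomogeneous d) {c : F} (hc : c ≠ 0) : HasMult m (c • v) f ↔ HasMult m v f := by
  have key : ∀ (w : σ → F) (c : F), c ≠ 0 → HasMult m (c • w) f → HasMult m w f := by
    intro w c hc h
    have h1 : HasMult m w (aeval (fun i => C c * X i) f) :=
      HasMult.comp (by simpa [Pi.smul_def] using h)
    rw [aeval_mul_of_isHomogeneous hf, aeval_X_left_apply, ← C_pow] at h1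
    have h2 := h1.mul_left (C (c ^ d)⁻¹)
    rwa [← mul_assoc, ← C_mul, inv_mul_cancel₀ (pow_ne_zero _ hc), C_1, one_mul] at h2
  refine ⟨key v c hc, fun h => key (c • v) c⁻¹ (inv_ne_zero hc) ?_⟩
  rwa [inv_smul_smul₀ hc]

end Multiplicity

/-! ### Trivial kernels under specialization -/

section Kernel

variable {R C : Type*} [Fintype R] [Fintype C] [DecidableEq C]

/-- The kernel of the matrix `M` is trivial. -/
def TrivialKer {A : Type*} [CommRing A] (M : Matrix R C A) : Prop :=
  ∀ c : C → A, M.mulVec c = 0 → c = 0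

theorem TrivialKer.of_mul_eq_smul {A : Type*} [CommRing A] [IsDomain A] {M : Matrix R C A}
    {L : Matrix C R A} {D : A} (hD : D ≠ 0) (h : L * M = D • 1) : TrivialKer M := by
  intro c hc
  have h1 : (L * M).mulVec c = 0 := by rw [← Matrix.mulVec_mulVec, hc, Matrix.mulVec_zero]
  rw [h, Matrix.smul_mulVec, Matrix.one_mulVec] at h1
  exact (smul_eq_zero.1 h1).resolve_left hD

theorem TrivialKer.exists_mul_eq_one {K : Type*} [Field K] {M : Matrix R C K}
    (h : TrivialKer M) : ∃ L : Matrix C R K, L * M = 1 := by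
  classical
  obtain ⟨g, hg⟩ := M.mulVecLin.exists_leftInverse_of_injective
    (LinearMap.ker_eq_bot'.2 fun c hc => h c hc)
  refine ⟨LinearMap.toMatrix' g, ?_⟩
  have h1 : LinearMap.toMatrix' (g ∘ₗ M.mulVecLin) = LinearMap.toMatrix' g * M := by
    rw [LinearMap.toMatrix'_comp, ← Matrix.toLin'_apply', LinearMap.toMatrix'_toLin']
  rw [← h1, hg, LinearMap.toMatrix'_id]

/-- Over the fraction field there is a left inverse; clearing its denominators leaves a single `D`,
outside whose zero set injectivity persists. -/
theorem TrivialKer.exists_mul_eq_smul {A : Type*} [CommRing A] [IsDomain A] {M : Matrix R C A}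
    (h : TrivialKer M) : ∃ (L : Matrix C R A) (D : A), D ≠ 0 ∧ L * M = D • 1 := by
  classical
  let F := FractionRing A
  have hF : TrivialKer (M.map (algebraMap A F)) := by
    intro c hc
    obtain ⟨s, hs⟩ := IsLocalization.exist_integer_multiples_of_finite (nonZeroDivisors A) c
    choose c' hc' using hs
    have hs0 : algebraMap A F s ≠ 0 := IsFractionRing.to_map_ne_zero_of_mem_nonZeroDivisors s.2
    have h1 : algebraMap A F ∘ c' = algebraMap A F s • c := by
      funext i
      simpa [Algebra.smul_def] using hc' i
    have h2 : c' = 0 := by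
      refine h c' ?_
      have h3 : algebraMap A F ∘ (M.mulVec c') = 0 := by
        have : algebraMap A F ∘ (M.mulVec c') =
            (M.map (algebraMap A F)).mulVec (algebraMap A F ∘ c') := by
          funext i
          exact RingHom.map_mulVec _ _ _ _
        rw [this, h1, Matrix.mulVec_smul, hc, smul_zero]
      funext i
      exact IsFractionRing.injective A F (by simpa using congrFun h3 i)
    rw [h2] at h1
    have h4 : algebraMap A F s • c = 0 := by
      rw [← h1]; funext i; simp
    exact (smul_eq_zero.1 h4).resolve_left hs0
  obtain ⟨L, hL⟩ := hF.exists_mul_eq_one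
  obtain ⟨s, hs⟩ := IsLocalization.exist_integer_multiples_of_finite (nonZeroDivisors A)
    (fun p : C × R => L p.1 p.2)
  choose L' hL' using hs
  let N : Matrix C R A := Matrix.of fun i j => L' (i, j)
  refine ⟨N, s, nonZeroDivisors.ne_zero s.2, ?_⟩
  have h1 : N.map (algebraMap A F) = algebraMap A F s • L := by
    ext i j
    have := hL' (i, j)
    rw [Algebra.smul_def] at this
    exact this
  have h2 : (N * M).map (algebraMap A F) =
      ((s : A) • (1 : Matrix C C A)).map (algebraMap A F) := by
    rw [Matrix.map_mul, h1, Matrix.smul_mul, hL]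
    ext i j
    by_cases hij : i = j <;> simp [hij]
  exact Matrix.map_injective (IsFractionRing.injective A F) h2

theorem TrivialKer.map_of_mul_eq_smul {A B : Type*} [CommRing A] [CommRing B] [IsDomain B]
    {M : Matrix R C A} {L : Matrix C R A} {D : A} (hL : L * M = D • 1) (φ : A →+* B)
    (hφ : φ D ≠ 0) : TrivialKer (M.map φ) := by
  refine TrivialKer.of_mul_eq_smul (L := L.map φ) hφ ?_
  rw [← Matrix.map_mul, hL]
  ext i j
  by_cases hij : i = j <;> simp [hij]

/-- If one specialization of `M` has trivial kernel, so have all specializations outside the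
zero set of some element. -/
theorem TrivialKer.exists_nonvanishing {K A : Type*} [Field K] [CommRing A] [Algebra K A]
    -- The element is the determinant of `L * M`, where `L` is a left inverse of the specialized
    -- matrix with its entries read as constants; the adjugate supplies the left factor.
    {M : Matrix R C A} (ψ : A →ₐ[K] K) (h : TrivialKer (M.map ψ)) :
    ∃ (D : A), ψ D ≠ 0 ∧ ∃ L : Matrix C R A, L * M = D • 1 := by
  obtain ⟨L, hL⟩ := h.exists_mul_eq_one
  set N : Matrix C C A := L.map (algebraMap K A) * M with hN
  refine ⟨N.det, ?_, N.adjugate * L.map (algebraMap K A), ?_⟩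
  · have h1 : N.map ψ = 1 := by
      have : N.map (ψ : A →+* K) = (L.map (algebraMap K A)).map (ψ : A →+* K) *
        M.map (ψ : A →+* K) := by rw [hN, Matrix.map_mul]
      have h2 : (L.map (algebraMap K A)).map (ψ : A →+* K) = L := by
        ext i j; simp
      rw [h2] at this
      exact this.trans hL
    have h2 : ψ N.det = 1 := by
      have h3 : (ψ : A →+* K) N.det = (N.map (ψ : A →+* K)).det := by
        rw [RingHom.map_det]; rfl
      have h4 : N.map (ψ : A →+* K) = 1 := h1
      rw [h4, Matrix.det_one] at h3
      exact h3
    rw [h2]; exact one_ne_zero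
  · rw [Matrix.mul_assoc, ← hN, Matrix.adjugate_mul]

end Kernel

/-! ### Forms with assigned multiplicities as kernel vectors -/

section Forms

variable {σ ι A B : Type*} [Fintype σ] [DecidableEq σ] [CommRing A] [CommRing B]

/-- There is a nonzero form of degree `d` with multiplicity at least `m i` at `v i`. -/
def HasForm (d : ℕ) (m : ι → ℕ) (v : ι → σ → A) : Prop :=
  ∃ f : MvPolynomial σ A, f ≠ 0 ∧ f.IsHomogeneous d ∧ ∀ i, HasMult (m i) (v i) f

/-- The exponents of the monomials of degree less than `m`. -/
def exponentsLT (σ : Type*) [Fintype σ] [DecidableEq σ] (m : ℕ) : Finset (σ →₀ ℕ) :=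
  (Finset.range m).biUnion fun k => Finset.univ.finsuppAntidiag k

/-- The exponents of the monomials of degree `d`. -/
def exponentsEq (σ : Type*) [Fintype σ] [DecidableEq σ] (d : ℕ) : Finset (σ →₀ ℕ) :=
  Finset.univ.finsuppAntidiag d

theorem mem_exponentsEq {d : ℕ} {e : σ →₀ ℕ} : e ∈ exponentsEq σ d ↔ e.degree = d := by
  simp [exponentsEq, Finset.mem_finsuppAntidiag, Finsupp.degree_eq_sum]

theorem mem_exponentsLT {m : ℕ} {e : σ →₀ ℕ} : e ∈ exponentsLT σ m ↔ e.degree < m := by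
  simp [exponentsLT, Finset.mem_finsuppAntidiag, Finsupp.degree_eq_sum]

/-- The matrix of the linear conditions that multiplicities `m i` at `v i` impose on forms of
degree `d`. -/
def conditions (d : ℕ) (m : ι → ℕ) (v : ι → σ → A) :
    Matrix (Σ i, exponentsLT σ (m i)) (exponentsEq σ d) A :=
  fun r c => (translate (v r.1) (monomial c.1 1)).coeff r.2.1

theorem conditions_map (φ : A →+* B) (d : ℕ) (m : ι → ℕ) (v : ι → σ → A) :
    (conditions d m v).map φ = conditions d m fun i => φ ∘ v i := by
  ext r c
  rw [Matrix.map_apply, conditions, conditions, ← coeff_map, ← translate_map, map_monomial,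
    map_one]

theorem hasForm_iff {d : ℕ} {m : ι → ℕ} {v : ι → σ → A} :
    HasForm d m v ↔ ¬ TrivialKer (conditions d m v) := by
  have key : ∀ c : exponentsEq σ d → A, (conditions d m v).mulVec c = 0 ↔
      ∀ i, HasMult (m i) (v i) (∑ e, monomial e.1 (c e)) := by
    intro c
    have h1 : ∀ (i : ι) (b : σ →₀ ℕ), (translate (v i) (∑ e, monomial e.1 (c e))).coeff b =
        ∑ e : exponentsEq σ d, (translate (v i) (monomial e.1 1)).coeff b * c e := by
      intro i b
      rw [map_sum, coeff_sum]
      refine Finset.sum_congr rfl fun e _ => ?_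
      have : (monomial e.1 (c e) : MvPolynomial σ A) = c e • monomial e.1 1 := by
        rw [smul_monomial, smul_eq_mul, mul_one]
      rw [this, map_smul, coeff_smul, smul_eq_mul, mul_comm]
    constructor
    · intro h i
      rw [hasMult_iff_coeff]
      intro b hb
      rw [h1]
      exact congrFun h ⟨i, b, mem_exponentsLT.2 hb⟩
    · intro h
      funext ⟨i, b, hb⟩
      have := hasMult_iff_coeff.1 (h i) b (mem_exponentsLT.1 hb)
      rw [h1] at this
      exact this
  unfold TrivialKer
  push Not
  constructor
  · rintro ⟨f, hf0, hfd, hf⟩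
    have hfs : ∑ e : exponentsEq σ d, monomial e.1 (f.coeff e.1) = f := by
      ext b
      rw [coeff_sum]
      by_cases hb : b.degree = d
      · rw [Finset.sum_eq_single ⟨b, mem_exponentsEq.2 hb⟩]
        · simp
        · intro e _ he
          rw [coeff_monomial, if_neg]
          exact fun h => he (Subtype.ext h)
        · simp
      · rw [hfd.coeff_eq_zero hb]
        refine Finset.sum_eq_zero fun e _ => ?_
        rw [coeff_monomial, if_neg]
        rintro rfl
        exact hb (mem_exponentsEq.1 e.2)
    refine ⟨fun e => f.coeff e.1, (key _).2 ?_, ?_⟩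
    · rw [hfs]; exact hf
    · intro h
      apply hf0
      rw [← hfs]
      refine Finset.sum_eq_zero fun e _ => ?_
      have := congrFun h e
      simp only [Pi.zero_apply] at this
      rw [this, map_zero]
  · rintro ⟨c, hc, hc0⟩
    refine ⟨_, ?_, ?_, (key c).1 hc⟩
    · obtain ⟨e, he⟩ := Function.ne_iff.1 hc0
      intro h
      have h2 := congrArg (coeff e.1) h
      rw [coeff_sum, Finset.sum_eq_single e] at h2
      · exact he (by simpa using h2)
      · intro e' _ he'
        rw [coeff_monomial, if_neg]
        exact fun h => he' (Subtype.ext h)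
      · simp
    · exact IsHomogeneous.sum _ _ _ fun e _ => isHomogeneous_monomial _ (mem_exponentsEq.1 e.2)

/-- If a generic tuple admits no form, neither do the tuples outside a hypersurface. -/
theorem exists_hypersurface_of_not_hasForm [Fintype ι] [IsDomain A] {d : ℕ} {m : ι → ℕ} {v : ι → σ → A}
    (h : ¬ HasForm d m v) : ∃ D : A, D ≠ 0 ∧ ∀ (K : Type*) [Field K] (φ : A →+* K),
      φ D ≠ 0 → ¬ HasForm d m (fun i => φ ∘ v i) := by
  rw [hasForm_iff, not_not] at h
  obtain ⟨L, D, hD, hL⟩ := h.exists_mul_eq_smul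
  refine ⟨D, hD, fun K _ φ hφ => ?_⟩
  rw [hasForm_iff, not_not, ← conditions_map]
  exact TrivialKer.map_of_mul_eq_smul hL φ hφ

/-- If a special tuple admits no form, neither do the tuples outside a hypersurface. -/
theorem exists_nonvanishing_of_not_hasForm [Fintype ι] {K : Type*} [Field K] [Algebra K A] {d : ℕ}
    {m : ι → ℕ} {v : ι → σ → A} (ψ : A →ₐ[K] K) (h : ¬ HasForm d m (fun i => ψ ∘ v i)) :
    ∃ D : A, ψ D ≠ 0 ∧ ∀ (B : Type*) [CommRing B] [IsDomain B] (φ : A →+* B),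
      φ D ≠ 0 → ¬ HasForm d m (fun i => φ ∘ v i) := by
  have h1 : TrivialKer ((conditions d m v).map (ψ : A →+* K)) := by
    rw [conditions_map, ← not_not (a := TrivialKer _), ← hasForm_iff]
    exact h
  obtain ⟨D, hD, L, hL⟩ := TrivialKer.exists_nonvanishing ψ h1
  refine ⟨D, hD, fun B _ _ φ hφ => ?_⟩
  rw [hasForm_iff, not_not, ← conditions_map]
  exact TrivialKer.map_of_mul_eq_smul hL φ hφ

end Forms

/-! ### Cancelling factors; multiplicity at coordinate points -/

section Multiplicity

variable {σ K : Type*} [Field K] {m : ℕ} {v : σ → K}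

/-- After translation `u` is a nonzero constant modulo the ideal of the variables, hence a unit
modulo every power of that ideal. -/
theorem HasMult.of_mul_left {u g : MvPolynomial σ K} (h : HasMult m v (u * g))
    (hu : eval v u ≠ 0) : HasMult m v g := by
  set I : Ideal (MvPolynomial σ K) := idealOfVars σ K with hI
  have h1 : translate v u - C (eval v u) ∈ I := by
    have : translate v u - C (eval v u) ∈ I ^ 1 := by
      rw [mem_pow_idealOfVars_iff']
      intro x hx
      have hx : x = 0 := (Finsupp.degree_eq_zero_iff x).1 (by omega)
      rw [hx, ← constantCoeff_eq, map_sub, constantCoeff_translate, constantCoeff_C, sub_self]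
    simpa using this
  have h2 : IsCoprime I (Ideal.span {translate v u}) := by
    rw [Ideal.isCoprime_iff_exists]
    refine ⟨-(C (eval v u)⁻¹ * (translate v u - C (eval v u))),
      I.neg_mem (I.mul_mem_left _ h1), C (eval v u)⁻¹ * translate v u,
      Ideal.mul_mem_left _ _ (Ideal.mem_span_singleton_self _), ?_⟩
    rw [mul_sub, ← C_mul, inv_mul_cancel₀ hu, C_1]
    ring
  obtain ⟨a, ha, b, hb, hab⟩ := Ideal.isCoprime_iff_exists.1 (h2.pow_left (m := m))
  obtain ⟨c, rfl⟩ := Ideal.mem_span_singleton'.1 hb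
  have h3 : translate v g = translate v g * a + c * translate v (u * g) := by
    rw [map_mul]
    linear_combination -(translate v g) * hab
  rw [HasMult, h3]
  exact Ideal.add_mem _ (Ideal.mul_mem_left _ _ ha) (Ideal.mul_mem_left _ _ h)

theorem HasMult.of_C_mul {A : Type*} [CommRing A] [IsDomain A] {v : σ → A} {c : A} (hc : c ≠ 0)
    {f : MvPolynomial σ A} (h : HasMult m v (C c * f)) : HasMult m v f := by
  rw [hasMult_iff_coeff] at h ⊢
  intro b hb
  have h1 := h b hb
  rw [map_mul, translate, aeval_C, algebraMap_eq, coeff_C_mul] at h1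
  exact (mul_eq_zero.1 h1).resolve_left hc

theorem degree_erase_add [DecidableEq σ] (e : σ →₀ ℕ) (i : σ) :
    (e.erase i).degree + e i = e.degree := by
  conv_rhs => rw [← Finsupp.erase_add_single i e]
  rw [map_add, Finsupp.degree_single]

/-- The multiplicity of a form at a coordinate point bounds its degree in that coordinate. -/
theorem HasMult.add_le_degree [DecidableEq σ] {f : MvPolynomial σ K} {n : ℕ} {i : σ}
    (hf : f.IsHomogeneous n) (h : HasMult m (Pi.single i 1) f) {e : σ →₀ ℕ} (he : e ∈ f.support) :
    e i + m ≤ n := by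
  -- Dehomogenize by `X i = 1`. By homogeneity distinct monomials stay distinct, so nothing cancels
  -- and each image has degree `n - e i`.
  have h1 := h.aeval_mem (B := MvPolynomial σ K) (idealOfVars σ K)
    (fun j => if j = i then 1 else X j) (by
      intro j
      by_cases hj : j = i
      · subst hj; simp
      · have : (X j : MvPolynomial σ K) ∈ idealOfVars σ K := Ideal.subset_span ⟨j, rfl⟩
        simpa [hj] using this)
  have h2 : ∀ (e : σ →₀ ℕ) (c : K), aeval (fun j => if j = i then 1 else X j) (monomial e c) =
      monomial (e.erase i) c := by
    intro e c
    rw [aeval_monomial, monomial_eq, ← Finsupp.mul_prod_erase' e i _ (by simp), if_pos rfl,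
      one_pow, one_mul, algebraMap_eq]
    congr 1
    refine Finsupp.prod_congr fun j hj => ?_
    rw [if_neg]
    rintro rfl
    simp at hj
  have h3 : coeff (e.erase i) (aeval (fun j => if j = i then 1 else X j) f) = coeff e f := by
    conv_lhs => rw [f.as_sum, map_sum, coeff_sum]
    rw [Finset.sum_eq_single e]
    · rw [h2, coeff_monomial, if_pos rfl]
    · intro e' he' hne
      rw [h2, coeff_monomial, if_neg]
      intro heq
      apply hne
      have h4 := degree_erase_add e' i
      have h5 := degree_erase_add e i
      have h6 : e'.degree = n := by
        by_contra hh; exact (mem_support_iff.1 he') (hf.coeff_eq_zero hh)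
      have h7 : e.degree = n := by
        by_contra hh; exact (mem_support_iff.1 he) (hf.coeff_eq_zero hh)
      rw [← Finsupp.erase_add_single i e', ← Finsupp.erase_add_single i e, heq]
      rw [heq] at h4
      congr 2
      omega
    · intro hh; rw [h2, coeff_monomial, if_pos rfl]; simpa using hh
  have h4 : m ≤ (e.erase i).degree := by
    refine (mem_pow_idealOfVars_iff m _).1 h1 _ ?_
    rw [mem_support_iff, h3]
    exact mem_support_iff.1 he
  have h5 := degree_erase_add e i
  have h7 : e.degree = n := by
    by_contra hh; exact (mem_support_iff.1 he) (hf.coeff_eq_zero hh)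
  omega

theorem hasMult_single_of_add_le [DecidableEq σ] {f : MvPolynomial σ K} {n : ℕ} {i : σ}
    (hf : f.IsHomogeneous n) (h : ∀ e ∈ f.support, e i + m ≤ n) :
    HasMult m (Pi.single i 1) f := by
  rw [f.as_sum]
  refine HasMult.sum _ fun e he => ?_
  have h7 : e.degree = n := by
    by_contra hh; exact (mem_support_iff.1 he) (hf.coeff_eq_zero hh)
  have h5 := degree_erase_add e i
  have h1 : monomial e (coeff e f) = X i ^ e i * monomial (e.erase i) (coeff e f) := by
    rw [X_pow_eq_monomial, monomial_mul, one_mul, Finsupp.single_add_erase]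
  rw [h1]
  refine HasMult.mul_left ?_ _
  have h2 : aeval (fun j => if j = i then 0 else X j) (monomial (e.erase i) (coeff e f)) =
      monomial (e.erase i) (coeff e f) := by
    rw [aeval_monomial, monomial_eq, algebraMap_eq]
    congr 1
    refine Finsupp.prod_congr fun j hj => ?_
    rw [if_neg]
    rintro rfl
    simp at hj
  rw [← h2]
  refine HasMult.comp ?_
  have h3 : (fun j => eval (Pi.single i (1 : K)) (if j = i then 0 else X j)) = (0 : σ → K) := by
    funext j
    by_cases hj : j = i
    · simp [hj]
    · simp [hj]
  rw [h3]
  have h4 : translate (0 : σ → K) = AlgHom.id K _ := by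
    ext j; simp [translate]
  rw [HasMult, h4, AlgHom.id_apply, monomial_mem_pow_idealOfVars_iff _ _ (mem_support_iff.1 he)]
  have := h e he
  omega

end Multiplicity

/-! ### Linear changes of coordinates -/

section Linear

variable {ι σ K : Type*} [Field K] [Fintype σ] [DecidableEq σ] {n : ℕ} {m : ι → ℕ}

/-- The linear substitution by the rows of a matrix. -/
def linearSubst (M : Matrix σ σ K) : MvPolynomial σ K →ₐ[K] MvPolynomial σ K :=
  aeval fun i => ∑ j, C (M i j) * X j

theorem linearSubst_mul_of_mul_eq_one {M N : Matrix σ σ K} (h : N * M = 1) (f : MvPolynomial σ K) :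
    linearSubst M (linearSubst N f) = f := by
  have : (linearSubst M).comp (linearSubst N) = AlgHom.id K _ := by
    ext1 i
    simp only [AlgHom.comp_apply, linearSubst, aeval_X, map_sum, map_mul, aeval_C, algebraMap_eq,
      Finset.mul_sum, AlgHom.id_apply]
    rw [Finset.sum_comm]
    have h1 : ∀ j, ∑ x, C (N i x) * (C (M x j) * X j) = C ((1 : Matrix σ σ K) i j) * X j := by
      intro j
      rw [← h, Matrix.mul_apply, map_sum, Finset.sum_mul]
      refine Finset.sum_congr rfl fun x _ => ?_
      rw [C_mul, mul_assoc]
    simp_rw [h1]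
    rw [Finset.sum_eq_single i]
    · simp
    · intro j _ hj
      rw [Matrix.one_apply_ne hj.symm]; simp
    · simp
  exact congrArg (fun φ : MvPolynomial σ K →ₐ[K] MvPolynomial σ K => φ f) this

theorem HasForm.mulVec {M : Matrix σ σ K} (hM : IsUnit M.det) {v : ι → σ → K}
    (h : HasForm n m v) : HasForm n m fun i => M.mulVec (v i) := by
  obtain ⟨f, hf0, hfn, hf⟩ := h
  refine ⟨linearSubst M⁻¹ f, ?_, ?_, ?_⟩
  · intro h0
    apply hf0
    rw [← linearSubst_mul_of_mul_eq_one (Matrix.nonsing_inv_mul M hM) f, h0, map_zero]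
  · have := hfn.aeval (fun i => ∑ j, C (M⁻¹ i j) * X j) (n := 1) (fun i =>
      IsHomogeneous.sum _ _ _ fun j _ => isHomogeneous_C_mul_X _ _)
    rwa [one_mul] at this
  · intro i
    refine HasMult.comp ?_
    have : (fun k => eval (M.mulVec (v i)) (∑ j, C (M⁻¹ k j) * X j)) = v i := by
      have h1 : M⁻¹.mulVec (M.mulVec (v i)) = v i := by
        rw [Matrix.mulVec_mulVec, Matrix.nonsing_inv_mul M hM, Matrix.one_mulVec]
      conv_rhs => rw [← h1]
      funext k
      simp [Matrix.mulVec, dotProduct]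
    rw [this]
    exact hf i

end Linear

/-! ### Degrees and multiplicities realized at every tuple -/

section Effective

variable (K : Type*) [Field K] {ι κ : Type*}

/-- For all `n`-tuples of points there is a nonzero form of degree `d` in four variables with
multiplicity at least `m i` at the `i`-th point; negative multiplicities impose no condition. -/
def Effective (d : ℤ) (m : ι → ℤ) : Prop :=
  ∀ v : ι → Fin 4 → K, ∃ n : ℕ, (n : ℤ) = d ∧ HasForm n (fun i => (m i).toNat) v

variable {K} {d d' : ℤ} {m m' : ι → ℤ}

theorem Effective.nonneg (h : Effective K d m) : 0 ≤ d := by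
  obtain ⟨n, hn, -⟩ := h 0
  omega

/-- Tuples may contain the zero vector. At the origin a nonzero form has multiplicity equal to its
degree. -/
theorem Effective.le (h : Effective K d m) (i : ι) : m i ≤ d := by
  obtain ⟨n, hn, f, hf0, hfn, hf⟩ := h 0
  by_contra hlt
  have h1 : n < (m i).toNat := by omega
  exact hf0 (eq_zero_of_hasMult_zero hfn h1 (hf i))

theorem Effective.comp (h : Effective K d m) {m' : κ → ℤ} (e : κ → ι) (he : Function.Injective e)
    (hm : ∀ k, m' k ≤ m (e k)) : Effective K d m' := by
  intro v
  obtain ⟨n, hn, f, hf0, hfn, hf⟩ := h (Function.extend e v 0)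
  refine ⟨n, hn, f, hf0, hfn, fun k => ?_⟩
  have h1 := hf (e k)
  rw [he.extend_apply] at h1
  exact h1.mono (Int.toNat_le_toNat (hm k))

theorem Effective.add (h : Effective K d m) (h' : Effective K d' m') :
    Effective K (d + d') (m + m') := by
  intro v
  obtain ⟨n, hn, f, hf0, hfn, hf⟩ := h v
  obtain ⟨n', hn', f', hf0', hfn', hf'⟩ := h' v
  refine ⟨n + n', by push_cast; omega, f * f', mul_ne_zero hf0 hf0', hfn.mul hfn', fun i => ?_⟩
  refine ((hf i).mul (hf' i)).mono ?_
  simp only [Pi.add_apply]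
  omega

theorem effective_zero : Effective K 0 (0 : ι → ℤ) := fun v =>
  ⟨0, rfl, 1, one_ne_zero, isHomogeneous_one _ _, fun i => by simpa using hasMult_zero_left⟩

theorem Effective.sum {τ : Type*} (s : Finset τ) {d : τ → ℤ} {m : τ → ι → ℤ}
    (h : ∀ t ∈ s, Effective K (d t) (m t)) : Effective K (∑ t ∈ s, d t) (∑ t ∈ s, m t) := by
  classical
  induction s using Finset.induction_on with
  | empty => simpa using effective_zero
  | insert a s ha ih =>
    rw [Finset.sum_insert ha, Finset.sum_insert ha]
    exact (h a (Finset.mem_insert_self _ _)).add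
      (ih fun t ht => h t (Finset.mem_insert_of_mem ht))

/-- No nonzero form of degree `d` has multiplicities `m i` at `v i`. -/
def NoForm (d : ℤ) (m : ι → ℤ) (v : ι → Fin 4 → K) : Prop :=
  ∀ n : ℕ, (n : ℤ) = d → ¬ HasForm n (fun i => (m i).toNat) v

theorem not_effective_iff : ¬ Effective K d m ↔ ∃ v : ι → Fin 4 → K, NoForm d m v := by
  simp only [Effective, NoForm, not_forall, not_exists, not_and]

theorem NoForm.mulVec {v : ι → Fin 4 → K} (h : NoForm d m v) {M : Matrix (Fin 4) (Fin 4) K}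
    (hM : IsUnit M.det) : NoForm d m fun i => M.mulVec (v i) := by
  intro n hn hF
  refine h n hn ?_
  have h1 := hF.mulVec (Matrix.isUnit_nonsing_inv_det M hM)
  simpa [Matrix.mulVec_mulVec, Matrix.nonsing_inv_mul M hM] using h1

/-- In a polynomial family of tuples, the absence of forms at one member allows one to choose a
member outside any given hypersurface. -/
theorem NoForm.exists_eval_ne_zero [Infinite K] [Fintype ι] {τ : Type*}
    (v : ι → Fin 4 → MvPolynomial τ K) (s : τ → K)
    (h : NoForm d m fun i j => eval s (v i j)) {P : MvPolynomial τ K} (hP : P ≠ 0) :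
    ∃ t : τ → K, eval t P ≠ 0 ∧ NoForm d m fun i j => eval t (v i j) := by
  by_cases hd : 0 ≤ d
  · lift d to ℕ using hd
    have h1 : ¬ HasForm d (fun i => (m i).toNat)
        (fun i => (aeval s : MvPolynomial τ K →ₐ[K] K) ∘ v i) := by
      have h2 : (fun i => (aeval s : MvPolynomial τ K →ₐ[K] K) ∘ v i) =
          fun i j => eval s (v i j) := by
        funext i j
        exact DFunLike.congr_fun (coe_aeval_eq_eval s) (v i j)
      rw [h2]
      exact h d rfl
    obtain ⟨D, hD, hD'⟩ := exists_nonvanishing_of_not_hasForm _ h1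
    have hD0 : D ≠ 0 := by rintro rfl; simp at hD
    have : ∃ t, eval t (P * D) ≠ 0 := by
      by_contra hall
      push Not at hall
      exact mul_ne_zero hP hD0 (MvPolynomial.funext fun t => by rw [hall t, map_zero])
    obtain ⟨t, ht⟩ := this
    rw [map_mul] at ht
    refine ⟨t, left_ne_zero_of_mul ht, fun n hn => ?_⟩
    obtain rfl : n = d := by exact_mod_cast hn
    exact hD' K (eval t) (right_ne_zero_of_mul ht)
  · have : ∃ t, eval t P ≠ 0 := by
      by_contra hall
      push Not at hall
      exact hP (MvPolynomial.funext fun t => by rw [hall t, map_zero])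
    obtain ⟨t, ht⟩ := this
    exact ⟨t, ht, fun n hn => by omega⟩

end Effective

/-! ### Inverting the coordinates -/

section Reciprocal

variable {σ K : Type*} [Field K] {m : ℕ}

/-- The polynomial `x ^ D * f (1 / x)`. -/
def reciprocal (D : σ →₀ ℕ) (f : MvPolynomial σ K) : MvPolynomial σ K :=
  ∑ e ∈ f.support, monomial (D - e) (coeff e f)

theorem exists_of_mem_support_reciprocal {D : σ →₀ ℕ} {f : MvPolynomial σ K} {b : σ →₀ ℕ}
    (hb : b ∈ (reciprocal D f).support) : ∃ e ∈ f.support, b = D - e := by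
  classical
  have := support_sum (s := f.support) (f := fun e => monomial (D - e) (coeff e f)) hb
  obtain ⟨e, he, hbe⟩ := Finset.mem_biUnion.1 this
  exact ⟨e, he, Finset.mem_singleton.1 (support_monomial_subset hbe)⟩

theorem reciprocal_ne_zero {D : σ →₀ ℕ} {f : MvPolynomial σ K} (hD : ∀ e ∈ f.support, e ≤ D)
    (hf : f ≠ 0) : reciprocal D f ≠ 0 := by
  classical
  obtain ⟨e, he⟩ := Finset.nonempty_iff_ne_empty.2 (mt support_eq_empty.1 hf)
  intro h
  have h1 := congrArg (coeff (D - e)) h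
  rw [reciprocal, coeff_sum, Finset.sum_eq_single e, coeff_monomial, if_pos rfl, coeff_zero] at h1
  · exact mem_support_iff.1 he h1
  · intro e' he' hne
    rw [coeff_monomial, if_neg]
    intro heq
    apply hne
    rw [← tsub_tsub_cancel_of_le (hD e' he'), heq, tsub_tsub_cancel_of_le (hD e he)]
  · exact fun hh => absurd he hh

theorem reciprocal_isHomogeneous {D : σ →₀ ℕ} {f : MvPolynomial σ K} {n k : ℕ}
    (hD : ∀ e ∈ f.support, e ≤ D) (hf : f.IsHomogeneous n) (hk : n + k = D.degree) :
    (reciprocal D f).IsHomogeneous k := by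
  refine IsHomogeneous.sum _ _ _ fun e he => isHomogeneous_monomial _ ?_
  have h7 : e.degree = n := by
    by_contra hh; exact (mem_support_iff.1 he) (hf.coeff_eq_zero hh)
  have h1 : (D - e).degree + e.degree = D.degree := by
    rw [← map_add, tsub_add_cancel_of_le (hD e he)]
  omega

/-- Modulo the `m`-th power of the maximal ideal at `u`, each `X i` is a nonzero constant plus a
nilpotent, so it has an inverse `y i`, congruent to `(u i)⁻¹`. There the reciprocal polynomial
equals `X ^ D * f(y)`, and `f(y)` vanishes. -/
theorem HasMult.reciprocal [Finite σ] {D : σ →₀ ℕ} {f : MvPolynomial σ K} {u : σ → K}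
    (hu : ∀ i, u i ≠ 0) (hD : ∀ e ∈ f.support, e ≤ D) (h : HasMult m (fun i => (u i)⁻¹) f) :
    HasMult m u (reciprocal D f) := by
  have := Fintype.ofFinite σ
  set I : Ideal (MvPolynomial σ K) := RingHom.ker (eval u) with hI
  set π := Ideal.Quotient.mk (I ^ m) with hπ
  have hXI : ∀ i, X i - C (u i) ∈ I := fun i => by simp [hI, RingHom.mem_ker]
  have hunit : ∀ i, IsUnit (π (X i)) := by
    intro i
    have h1 : IsNilpotent (π (X i - C (u i))) :=
      ⟨m, by rw [← map_pow]; exact Ideal.Quotient.eq_zero_iff_mem.2 (Ideal.pow_mem_pow (hXI i) m)⟩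
    have h2 : IsUnit (π (C (u i))) := ((IsUnit.mk0 _ (hu i)).map C).map π
    have h3 : π (X i) = π (X i - C (u i)) + π (C (u i)) := by rw [← map_add, sub_add_cancel]
    rw [h3]
    exact h1.isUnit_add_right_of_commute h2 (Commute.all _ _)
  choose y hy using fun i => (hunit i).exists_right_inv
  have h1 := h.aeval_mem (I.map π) y (by
    intro i
    have h2 : y i - algebraMap K _ (u i)⁻¹ = y i * algebraMap K _ (u i)⁻¹ * π (C (u i) - X i) := by
      have h3 : algebraMap K (MvPolynomial σ K ⧸ I ^ m) (u i)⁻¹ * π (C (u i)) = 1 := by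
        have : π (C (u i)) = algebraMap K (MvPolynomial σ K ⧸ I ^ m) (u i) := rfl
        rw [this, ← map_mul, inv_mul_cancel₀ (hu i), map_one]
      rw [map_sub]
      linear_combination (-(y i)) * h3 + algebraMap K (MvPolynomial σ K ⧸ I ^ m) (u i)⁻¹ * hy i
    rw [h2]
    refine Ideal.mul_mem_left _ _ (Ideal.mem_map_of_mem _ ?_)
    rw [← neg_sub]
    exact I.neg_mem (hXI i))
  have h2 : (I.map π) ^ m = ⊥ := by
    rw [← Ideal.map_pow, hπ, Ideal.map_quotient_self]
  rw [h2, Ideal.mem_bot] at h1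
  refine hasMult_of_mem_pow (I := I) (fun g hg => hg) ?_
  rw [← Ideal.Quotient.eq_zero_iff_mem]
  have h3 : π (FatPoints.reciprocal D f) = (∏ i, π (X i) ^ D i) * aeval y f := by
    conv_rhs => rw [f.as_sum]
    rw [FatPoints.reciprocal, map_sum, map_sum, Finset.mul_sum]
    refine Finset.sum_congr rfl fun e he => ?_
    rw [monomial_eq, map_mul, aeval_monomial, Finsupp.prod_fintype _ _ (by simp),
      Finsupp.prod_fintype _ _ (by simp), map_prod, mul_left_comm, ← Finset.prod_mul_distrib]
    congr 1
    refine Finset.prod_congr rfl fun i _ => ?_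
    have h4 : D i = (D - e) i + e i := by
      rw [Finsupp.tsub_apply, tsub_add_cancel_of_le (hD e he i)]
    rw [map_pow]
    conv_rhs => rw [h4, pow_add, mul_assoc, ← mul_pow, hy, one_pow, mul_one]
  change π (FatPoints.reciprocal D f) = 0
  rw [h3, h1, mul_zero]

end Reciprocal

/-! ### The standard Cremona transformation -/

section Cremona

variable {K : Type*} [Field K] [Infinite K] {κ : Type*} [Fintype κ]

/-- Openness is used twice: first to make the first four vectors a basis, which a linear map takes
to the coordinate points, then to move the other points off the coordinate planes with those four
fixed. -/
theorem exists_noForm_single {d : ℤ} {a : Fin 4 → ℤ} {b : κ → ℤ}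
    (h : ¬ Effective K d (Sum.elim a b)) : ∃ u : κ → Fin 4 → K, (∀ k i, u k i ≠ 0) ∧
      NoForm d (Sum.elim a b) (Sum.elim (fun i => Pi.single i 1) u) := by
  classical
  obtain ⟨v₀, hv₀⟩ := not_effective_iff.1 h
  obtain ⟨t, ht, hn⟩ := NoForm.exists_eval_ne_zero (K := K) (τ := (Fin 4 ⊕ κ) × Fin 4)
    (fun i j => X (i, j)) (fun p => v₀ p.1 p.2) (by simpa using hv₀)
    (P := (Matrix.of fun i j => X (Sum.inl j, i) : Matrix (Fin 4) (Fin 4) _).det) (by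
      intro h0
      have h1 := congrArg (eval fun p : (Fin 4 ⊕ κ) × Fin 4 =>
        Sum.elim (fun i => if i = p.2 then (1 : K) else 0) 0 p.1) h0
      rw [RingHom.map_det, map_zero] at h1
      have h2 : (RingHom.mapMatrix (eval fun p : (Fin 4 ⊕ κ) × Fin 4 =>
        Sum.elim (fun i => if i = p.2 then (1 : K) else 0) 0 p.1))
        (Matrix.of fun i j => X (Sum.inl j, i)) = (1 : Matrix (Fin 4) (Fin 4) K) := by
        ext i j
        simp [Matrix.one_apply, eq_comm]
      rw [h2, Matrix.det_one] at h1
      exact one_ne_zero h1)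
  set M : Matrix (Fin 4) (Fin 4) K := Matrix.of fun i j => t (Sum.inl j, i) with hM
  have hMu : IsUnit M.det := by
    rw [isUnit_iff_ne_zero]
    rw [RingHom.map_det] at ht
    convert ht using 2
    ext i j
    simp [hM]
  have h1 := hn.mulVec (Matrix.isUnit_nonsing_inv_det M hMu)
  simp only [eval_X] at h1
  set w : κ → Fin 4 → K := fun k => M⁻¹.mulVec fun j => t (Sum.inr k, j) with hw
  have h2 : NoForm d (Sum.elim a b) (Sum.elim (fun i => Pi.single i 1) w) := by
    convert h1 using 1
    funext x
    rcases x with i | k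
    · have : (fun j => t (Sum.inl i, j)) = M.mulVec (Pi.single i 1) := by
        rw [Matrix.mulVec_single_one]; rfl
      rw [this, Matrix.mulVec_mulVec, Matrix.nonsing_inv_mul M hMu, Matrix.one_mulVec]
      rfl
    · rfl
  obtain ⟨s, hs, hn'⟩ := NoForm.exists_eval_ne_zero (K := K) (τ := κ × Fin 4)
    (Sum.elim (fun i j => C (if j = i then 1 else 0)) fun k j => X (k, j)) (fun p => w p.1 p.2) (by
      convert h2 using 1
      funext x
      rcases x with i | k
      · funext j
        by_cases hj : j = i
        · subst hj; simp
        · simp [hj]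
      · simp)
    (P := ∏ p : κ × Fin 4, X p) (Finset.prod_ne_zero_iff.2 fun p _ => X_ne_zero p)
  refine ⟨fun k i => s (k, i), fun k i => ?_, ?_⟩
  · rw [map_prod, Finset.prod_ne_zero_iff] at hs
    simpa using hs (k, i) (Finset.mem_univ _)
  · convert hn' using 1
    funext x
    rcases x with i | k
    · funext j
      by_cases hj : j = i
      · subst hj; simp
      · simp [hj]
    · simp

/-- The standard Cremona transformation of `ℙ³` based at the first four points. -/
theorem Effective.cremona_sum {d : ℤ} {a : Fin 4 → ℤ} {b : κ → ℤ}
    (h : Effective K d (Sum.elim a b)) :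
    Effective K (3 * d - ∑ i, a i) (Sum.elim (fun i => a i + (2 * d - ∑ i, a i)) b) := by
  classical
  by_contra hne
  obtain ⟨u, hu, hno⟩ := exists_noForm_single hne
  obtain ⟨n, hn, f, hf0, hfn, hf⟩ :=
    h (Sum.elim (fun i => Pi.single i 1) fun k i => (u k i)⁻¹)
  have hle : ∀ e ∈ f.support, ∀ i, (e i : ℤ) ≤ d - a i := by
    intro e he i
    have h1 := (hf (Sum.inl i)).add_le_degree hfn he
    simp only [Sum.elim_inl] at h1
    omega
  obtain ⟨e₀, he₀⟩ := Finset.nonempty_iff_ne_empty.2 (mt support_eq_empty.1 hf0)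
  -- The exponent `d - a i` bounds the degree in `x_i` of every form with these multiplicities. It
  -- equals the new degree minus the new multiplicity, so the same bound read backwards gives the
  -- new multiplicities.
  let D : Fin 4 →₀ ℕ := Finsupp.equivFunOnFinite.symm fun i => (d - a i).toNat
  have hDi : ∀ i, (D i : ℤ) = d - a i := by
    intro i
    have h1 := hle e₀ he₀ i
    change ((d - a i).toNat : ℤ) = _
    omega
  have hD : ∀ e ∈ f.support, e ≤ D := by
    intro e he i
    have h1 := hle e he i
    have h2 := hDi i
    omega
  have hdeg : ∀ e ∈ f.support, e.degree = n := fun e he => by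
    by_contra hh; exact (mem_support_iff.1 he) (hfn.coeff_eq_zero hh)
  have hDn : n ≤ D.degree := by
    rw [← hdeg e₀ he₀]; exact Finsupp.degree_mono (hD e₀ he₀)
  have hDs : (D.degree : ℤ) = 4 * d - ∑ i, a i := by
    rw [Finsupp.degree_eq_sum, Nat.cast_sum]
    simp only [hDi, Finset.sum_sub_distrib]
    simp
  have hhom := reciprocal_isHomogeneous (k := D.degree - n) hD hfn (by omega)
  refine hno (D.degree - n) (by omega) ⟨reciprocal D f, reciprocal_ne_zero hD hf0, hhom, ?_⟩
  rintro (i | k)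
  · refine hasMult_single_of_add_le hhom fun b hb => ?_
    obtain ⟨e, he, rfl⟩ := exists_of_mem_support_reciprocal hb
    have h1 := hDi i
    have h2 : (D - e).degree + e.degree = D.degree := by
      rw [← map_add, tsub_add_cancel_of_le (hD e he)]
    have h3 := hdeg e he
    have h4 := Finsupp.le_degree i (D - e)
    have h5 : (D - e) i ≤ D i := by rw [Finsupp.tsub_apply]; exact Nat.sub_le _ _
    simp only [Sum.elim_inl]
    omega
  · exact (hf (Sum.inr k)).reciprocal (hu k) hD

end Cremona

/-! ### One-parameter families and powers of the parameter -/

section PowerFactor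

variable {σ K : Type*} [Field K]

local notation "T" => (Polynomial.X : Polynomial K)

theorem exists_eq_C_pow_mul {f : MvPolynomial σ (Polynomial K)} (hf : f ≠ 0) :
    ∃ (s : ℕ) (g : MvPolynomial σ (Polynomial K)), f = C (T ^ s) * g ∧
      map (Polynomial.evalRingHom 0) g ≠ 0 := by
  have hp : Prime (C (σ := σ) T) := (prime_C_iff (σ := σ)).2 Polynomial.prime_X
  obtain ⟨s, g, hg, rfl⟩ := WfDvdMonoid.max_power_factor hf hp.irreducible
  refine ⟨s, g, by rw [C_pow], fun h => hg ?_⟩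
  rw [C_dvd_iff_dvd_coeff]
  intro e
  have h1 := congrArg (coeff e) h
  rw [coeff_map, coeff_zero] at h1
  rw [Polynomial.X_dvd_iff, Polynomial.coeff_zero_eq_eval_zero]
  exact h1

theorem mem_support_map_eval_zero {g : MvPolynomial σ (Polynomial K)} {e : σ →₀ ℕ} :
    e ∈ (map (Polynomial.evalRingHom 0) g).support ↔ ¬ T ∣ coeff e g := by
  rw [mem_support_iff, coeff_map, Polynomial.X_dvd_iff, Polynomial.coeff_zero_eq_eval_zero]
  rfl

theorem isHomogeneous_of_C_mul {f : MvPolynomial σ (Polynomial K)} {c : Polynomial K} (hc : c ≠ 0)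
    {n : ℕ} (h : (C c * f).IsHomogeneous n) : f.IsHomogeneous n := by
  intro e he
  refine h ?_
  rw [coeff_C_mul]
  exact mul_ne_zero hc he

theorem le_of_pow_dvd_pow_mul {s a : ℕ} {c : Polynomial K} (hc : ¬ T ∣ c)
    (h : T ^ s ∣ T ^ a * c) : s ≤ a := by
  have h1 := Polynomial.prime_X.pow_dvd_of_dvd_mul_right s hc h
  exact (pow_dvd_pow_iff Polynomial.X_ne_zero Polynomial.not_isUnit_X).1 h1

/-- The substitution `x_j ↦ T * x_j` for `j ≠ i`. -/
def contract [DecidableEq σ] (i : σ) :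
    MvPolynomial σ (Polynomial K) →ₐ[Polynomial K] MvPolynomial σ (Polynomial K) :=
  aeval fun j => C (if j = i then 1 else T) * X j

theorem coeff_contract [Fintype σ] [DecidableEq σ] (i : σ) {n : ℕ}
    {f : MvPolynomial σ (Polynomial K)} (hf : f.IsHomogeneous n) (e : σ →₀ ℕ) :
    coeff e (contract i f) = T ^ (n - e i) * coeff e f := by
  have key : ∀ (b : σ →₀ ℕ) (c : Polynomial K), contract i (monomial b c) =
      monomial b (T ^ (b.erase i).degree * c) := by
    intro b c
    rw [contract, aeval_monomial, Finsupp.prod_fintype _ _ (by simp), monomial_eq,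
      Finsupp.prod_fintype _ _ (by simp), algebraMap_eq, C_mul]
    simp only [mul_pow, Finset.prod_mul_distrib]
    have h1 : ∏ j, C (if j = i then 1 else T) ^ b j =
        (C (T ^ (b.erase i).degree) : MvPolynomial σ (Polynomial K)) := by
      rw [Finsupp.degree_eq_sum, ← Finset.prod_pow_eq_pow_sum, map_prod]
      refine Finset.prod_congr rfl fun j _ => ?_
      by_cases hj : j = i
      · simp [hj]
      · simp [hj, Finsupp.erase_ne]
    rw [h1]
    ring
  conv_lhs => rw [f.as_sum, map_sum, coeff_sum]
  simp only [key, coeff_monomial]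
  rw [Finset.sum_ite_eq']
  split_ifs with he
  · have h7 : e.degree = n := by
      by_contra hh; exact (mem_support_iff.1 he) (hf.coeff_eq_zero hh)
    have := degree_erase_add e i
    congr 2
    omega
  · rw [notMem_support_iff.1 he, mul_zero]

theorem contract_isHomogeneous [DecidableEq σ] (i : σ) {n : ℕ}
    {f : MvPolynomial σ (Polynomial K)} (hf : f.IsHomogeneous n) :
    (contract i f).IsHomogeneous n := by
  have := hf.aeval (fun j => C (if j = i then 1 else T) * X j) (n := 1)
    (fun j => isHomogeneous_C_mul_X _ _)
  rwa [one_mul] at this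

end PowerFactor

/-! ### Collision of points -/

section Glue

variable {K : Type*} [Field K] [Infinite K] {ι κ : Type*} [Fintype ι] [Fintype κ]

omit [Infinite K] [Fintype ι] [Fintype κ] in
-- The degree is corrected by multiplying or dividing by a power of `X 0`; since no point lies on
-- that plane, division does not lower the multiplicities.
theorem hasForm_of_add_le {n s k : ℕ} {m : ι → ℕ} {p : ι → Fin 4 → K} (hp : ∀ i, p i 0 ≠ 0)
    {h : MvPolynomial (Fin 4) K} (h0 : h ≠ 0) (hn : h.IsHomogeneous n)
    (hm : ∀ i, HasMult (m i) (p i) h) (hs : ∀ e ∈ h.support, n ≤ e 0 + s) (hsk : s ≤ k) :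
    HasForm k m p := by
  rcases le_total n k with hnk | hnk
  · refine ⟨X 0 ^ (k - n) * h, mul_ne_zero (pow_ne_zero _ (X_ne_zero _)) h0, ?_,
      fun i => (hm i).mul_left _⟩
    have := (isHomogeneous_X_pow (R := K) (0 : Fin 4) (k - n)).mul hn
    rwa [Nat.sub_add_cancel hnk] at this
  · have hdvd : (X 0 : MvPolynomial (Fin 4) K) ^ (n - k) ∣ h := by
      rw [h.as_sum]
      refine Finset.dvd_sum fun e he => ?_
      rw [X_pow_eq_monomial, monomial_dvd_monomial]
      refine ⟨Or.inr fun i => ?_, one_dvd _⟩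
      have := hs e he
      by_cases hi : i = 0
      · subst hi; rw [Finsupp.single_eq_same]; omega
      · rw [Finsupp.single_eq_of_ne hi]; exact Nat.zero_le _
    obtain ⟨g, rfl⟩ := hdvd
    refine ⟨g, right_ne_zero_of_mul h0, ?_, fun i => (hm i).of_mul_left ?_⟩
    · intro e he
      have h1 : coeff (Finsupp.single 0 (n - k) + e) (X 0 ^ (n - k) * g) ≠ 0 := by
        rw [X_pow_eq_monomial, coeff_monomial_mul, one_mul]; exact he
      have h2 := hn h1
      rw [map_add] at h2
      simp only [Finsupp.weight_single] at h2
      simp only [Pi.one_apply, smul_eq_mul, mul_one] at h2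
      omega
    · rw [map_pow, eval_X]; exact pow_ne_zero _ (hp i)

omit [Fintype κ] in
theorem exists_noForm_first_ne_zero {d : ℤ} {m : ι → ℤ}
    (h : ¬ Effective K d m) : ∃ p : ι → Fin 4 → K, (∀ i, p i 0 ≠ 0) ∧ NoForm d m p := by
  obtain ⟨v, hv⟩ := not_effective_iff.1 h
  obtain ⟨t, ht, hno⟩ := NoForm.exists_eval_ne_zero (K := K) (τ := ι × Fin 4)
    (fun i j => X (i, j)) (fun p => v p.1 p.2) (by simpa using hv)
    (P := ∏ i, X (i, 0)) (Finset.prod_ne_zero_iff.2 fun p _ => X_ne_zero _)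
  refine ⟨fun i j => t (i, j), fun i => ?_, by simpa using hno⟩
  rw [map_prod, Finset.prod_ne_zero_iff] at ht
  simpa using ht i (Finset.mem_univ _)

/-- The identity matrix with column 0 replaced by the point has determinant its coordinate 0, which
may be assumed nonzero. -/
theorem exists_noForm_single_zero {d : ℤ} {m : Unit ⊕ κ → ℤ} (h : ¬ Effective K d m) :
    ∃ q : κ → Fin 4 → K, NoForm d m (Sum.elim (fun _ => Pi.single 0 1) q) := by
  obtain ⟨p, hp, hno⟩ := exists_noForm_first_ne_zero h
  set M : Matrix (Fin 4) (Fin 4) K := (1 : Matrix (Fin 4) (Fin 4) K).updateCol 0 (p (Sum.inl ()))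
    with hM
  have hMd : M.det = p (Sum.inl ()) 0 := by
    rw [hM, ← Matrix.cramer_apply, Matrix.cramer_one]
    rfl
  have hMu : IsUnit M.det := by
    rw [hMd]; exact IsUnit.mk0 _ (hp _)
  refine ⟨fun k => M⁻¹.mulVec (p (Sum.inr k)), ?_⟩
  convert hno.mulVec (Matrix.isUnit_nonsing_inv_det M hMu) using 1
  funext x
  rcases x with i | k
  · have : p (Sum.inl i) = M.mulVec (Pi.single 0 1) := by
      rw [Matrix.mulVec_single_one, hM]
      funext j
      simp [Matrix.col_apply]
    rw [this, Matrix.mulVec_mulVec, Matrix.nonsing_inv_mul M hMu, Matrix.one_mulVec]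
    rfl
  · rfl

/-- Points colliding at one point: if no form of degree `k` has multiplicities `m₁`, then a form
with multiplicities `m₁`, `m₂` degenerates to one with multiplicities `k + 1`, `m₂`. -/
theorem Effective.glue_sum {d : ℤ} {m₁ : ι → ℤ} {m₂ : κ → ℤ}
    (h : Effective K d (Sum.elim m₁ m₂)) (k : ℕ) (hk : ¬ Effective K k m₁) :
    Effective K d (Sum.elim (fun _ : Unit => (k : ℤ) + 1) m₂) := by
  by_contra hne
  obtain ⟨p, hp, hpno⟩ := exists_noForm_first_ne_zero hk
  obtain ⟨q, hqno⟩ := exists_noForm_single_zero hne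
  have hd := h.nonneg
  lift d to ℕ using hd
  -- With parameter `T`, the first group `(p₀ : T p₁ : T p₂ : T p₃)` tends to `(1 : 0 : 0 : 0)` at
  -- `T = 0`; the second group stays fixed.
  let V : ι ⊕ κ → Fin 4 → Polynomial K := Sum.elim
    (fun i j => (if j = 0 then 1 else Polynomial.X) * Polynomial.C (p i j))
    fun k j => Polynomial.C (q k j)
  have hV : HasForm d (fun i => (Sum.elim m₁ m₂ i).toNat) V := by
    by_contra hV
    obtain ⟨D, hD, hD'⟩ := exists_hypersurface_of_not_hasForm hV
    have : ∃ t, D.eval t ≠ 0 := by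
      by_contra hall
      push Not at hall
      exact hD (Polynomial.funext fun t => by rw [hall t, Polynomial.eval_zero])
    obtain ⟨t, ht⟩ := this
    obtain ⟨n, hn, hF⟩ := h fun i => Polynomial.evalRingHom t ∘ V i
    obtain rfl : n = d := by exact_mod_cast hn
    exact hD' K (Polynomial.evalRingHom t) ht hF
  obtain ⟨F, hF0, hFd, hF⟩ := hV
  obtain ⟨s₀, f, rfl, hf0⟩ := exists_eq_C_pow_mul hF0
  have hT : ∀ s : ℕ, (Polynomial.X ^ s : Polynomial K) ≠ 0 := fun s =>
    pow_ne_zero _ Polynomial.X_ne_zero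
  have hfd := isHomogeneous_of_C_mul (hT s₀) hFd
  have hf : ∀ i, HasMult _ (V i) f := fun i => (hF i).of_C_mul (hT s₀)
  have hg0 : contract 0 f ≠ 0 := by
    obtain ⟨e, he⟩ := Finset.nonempty_iff_ne_empty.2 (mt support_eq_empty.1 hf0)
    intro h0
    have h1 := coeff_contract 0 hfd e
    rw [h0, coeff_zero] at h1
    have h2 := (mul_eq_zero.1 h1.symm).resolve_left (hT _)
    exact mem_support_map_eval_zero.1 he (h2 ▸ dvd_zero _)
  -- The exponent `s` is the order in `T` of the rescaled form. It decides between the two cases: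
  -- the limit of `f` has multiplicity at least `s` at the collision point, while the limit of `g`,
  -- up to powers of `X 0`, is a form of degree at most `s` for the points `p`.
  obtain ⟨s, g, hg, hg1⟩ := exists_eq_C_pow_mul hg0
  have hgd : g.IsHomogeneous d :=
    isHomogeneous_of_C_mul (hT s) (hg ▸ contract_isHomogeneous 0 hfd)
  have hcoeff : ∀ e, Polynomial.X ^ s * coeff e g = Polynomial.X ^ (d - e 0) * coeff e f := by
    intro e
    rw [← coeff_contract 0 hfd e, hg, coeff_C_mul]
  have hdeg : ∀ (φ : MvPolynomial (Fin 4) K), φ.IsHomogeneous d → ∀ e ∈ φ.support, e 0 ≤ d := by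
    intro φ hφ e he
    have h7 : e.degree = d := by
      by_contra hh; exact (mem_support_iff.1 he) (hφ.coeff_eq_zero hh)
    have := Finsupp.le_degree 0 e
    omega
  have hf1 : ∀ e ∈ (map (Polynomial.evalRingHom 0) f).support, e 0 + s ≤ d := by
    intro e he
    have h1 := le_of_pow_dvd_pow_mul (mem_support_map_eval_zero.1 he) ⟨_, (hcoeff e).symm⟩
    have h2 := hdeg _ (hfd.map _) e he
    omega
  have hg2 : ∀ e ∈ (map (Polynomial.evalRingHom 0) g).support, d ≤ e 0 + s := by
    intro e he
    have h1 := le_of_pow_dvd_pow_mul (mem_support_map_eval_zero.1 he) ⟨_, (hcoeff e)⟩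
    omega
  -- If `s ≤ k`, the limit of `g` contradicts the choice of `p`; otherwise `s ≥ k + 1`, and the
  -- limit of `f` contradicts the choice of `q`.
  by_cases hsk : s ≤ k
  · refine hpno k rfl (hasForm_of_add_le hp hg1 (hgd.map _) (fun i => ?_) hg2 hsk)
    have h1 : HasMult (m₁ i).toNat (fun j => Polynomial.C (p i j)) (contract 0 f) := by
      refine HasMult.comp ?_
      have h2 : HasMult (m₁ i).toNat (V (Sum.inl i)) f := hf (Sum.inl i)
      convert h2 using 1
      funext j
      simp [V]
    rw [hg] at h1
    have h2 := (h1.of_C_mul (hT s)).map (Polynomial.evalRingHom 0)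
    convert h2 using 1
    funext j
    simp
  · refine hqno d rfl ⟨map (Polynomial.evalRingHom 0) f, hf0, hfd.map _, ?_⟩
    rintro (i | j)
    · refine hasMult_single_of_add_le (hfd.map _) fun e he => ?_
      have := hf1 e he
      simp only [Sum.elim_inl]
      omega
    · have h1 : HasMult (m₂ j).toNat (V (Sum.inr j)) f := hf (Sum.inr j)
      have h2 := h1.map (Polynomial.evalRingHom 0)
      change HasMult (m₂ j).toNat (q j) _
      convert h2 using 1
      funext l
      simp [V]

end Glue

/-! ### Unordered multiplicities; the inequalities for eight and for one plus nine points -/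

section Multisets

variable (K : Type*) [Field K]

/-- `Effective` for a multiset of multiplicities. -/
def EffectiveM (d : ℤ) (s : Multiset ℤ) : Prop :=
  Effective K d fun x : s => (x : ℤ)

variable {K} {d d' : ℤ} {s t : Multiset ℤ}

theorem exists_equiv_of_map_univ_eq {ι κ : Type*} [Fintype ι] [Fintype κ] {m : ι → ℤ} {m' : κ → ℤ}
    (h : Finset.univ.val.map m = Finset.univ.val.map m') : ∃ e : ι ≃ κ, ∀ i, m' (e i) = m i := by
  classical
  have h1 : ∀ c, Fintype.card {i // m i = c} = Fintype.card {k // m' k = c} := by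
    intro c
    have h2 := congrArg (Multiset.count c) h
    rw [Multiset.count_map, Multiset.count_map] at h2
    rw [Fintype.card_subtype, Fintype.card_subtype, Finset.card_def, Finset.card_def,
      Finset.filter_val, Finset.filter_val]
    simpa only [eq_comm] using h2
  exact ⟨Equiv.ofFiberEquiv fun c => Fintype.equivOfCardEq (h1 c),
    fun i => Equiv.ofFiberEquiv_map _ i⟩

theorem effectiveM_iff {ι : Type*} [Fintype ι] {m : ι → ℤ}
    (hs : Finset.univ.val.map m = s) : EffectiveM K d s ↔ Effective K d m := by
  obtain ⟨e, he⟩ := exists_equiv_of_map_univ_eq (hs.trans (Multiset.map_univ_coe s).symm)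
  refine ⟨fun h => h.comp e e.injective fun i => (he i).ge, fun h => h.comp e.symm
    e.symm.injective fun i => ?_⟩
  rw [← he, e.apply_symm_apply]

theorem map_univ_sum {ι κ : Type*} [Fintype ι] [Fintype κ] (m : ι → ℤ) (m' : κ → ℤ) :
    (Finset.univ : Finset (ι ⊕ κ)).val.map (Sum.elim m m') =
      Finset.univ.val.map m + Finset.univ.val.map m' := by
  rw [← Finset.univ_disjSum_univ, Finset.val_disjSum, Multiset.map_disjSum]
  rfl

theorem effectiveM_add_iff {ι κ : Type*} [Fintype ι] [Fintype κ] {m : ι → ℤ} {m' : κ → ℤ}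
    (hs : Finset.univ.val.map m = s) (ht : Finset.univ.val.map m' = t) :
    EffectiveM K d (s + t) ↔ Effective K d (Sum.elim m m') :=
  effectiveM_iff (by rw [map_univ_sum, hs, ht])

theorem exists_fin_map (s : Multiset ℤ) {n : ℕ} (hn : s.card = n) :
    ∃ m : Fin n → ℤ, Finset.univ.val.map m = s := by
  obtain ⟨l, rfl⟩ : ∃ l : List ℤ, (l : Multiset ℤ) = s := ⟨s.toList, s.coe_toList⟩
  rw [Multiset.coe_card] at hn
  subst hn
  exact ⟨l.get, by rw [Fin.univ_val_map, List.ofFn_get]⟩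

theorem EffectiveM.nonneg (h : EffectiveM K d s) : 0 ≤ d := Effective.nonneg h

theorem EffectiveM.left (h : EffectiveM K d (s + t)) : EffectiveM K d s := by
  rw [effectiveM_add_iff (Multiset.map_univ_coe s) (Multiset.map_univ_coe t)] at h
  exact h.comp Sum.inl Sum.inl_injective fun _ => le_rfl

theorem EffectiveM.le {m : ℤ} (h : EffectiveM K d ({m} + t)) : m ≤ d := by
  have h1 := (effectiveM_iff (ι := Unit) (m := fun _ => m) (by simp)).1 h.left
  exact h1.le ()

theorem EffectiveM.nsmul (h : EffectiveM K d s) (n : ℕ) :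
    EffectiveM K (n * d) (s.map fun m => n * m) := by
  rw [effectiveM_iff (ι := s) (m := fun x => n * (x : ℤ))]
  · have h1 := Effective.sum (Finset.range n) fun _ _ => h
    simp only [Finset.sum_const, Finset.card_range, nsmul_eq_mul] at h1
    exact h1
  · conv_rhs => rw [← Multiset.map_univ_coe s, Multiset.map_map]
    rfl

theorem EffectiveM.nsmul_nsmul_singleton {m : ℤ} {k : ℕ} (h : EffectiveM K d (k • {m})) (n : ℕ) :
    EffectiveM K (n * d) (k • {n * m}) := by
  have := h.nsmul n
  rwa [Multiset.map_nsmul, Multiset.map_singleton] at this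

theorem map_univ_const {n : ℕ} (m : ℤ) :
    (Finset.univ : Finset (Fin n)).val.map (fun _ => m) = n • ({m} : Multiset ℤ) := by
  rw [Multiset.map_const', Multiset.nsmul_singleton]
  simp

variable [Infinite K]

theorem EffectiveM.glue (h : EffectiveM K d (s + t)) {k : ℕ} (hk : ¬ EffectiveM K k s) :
    EffectiveM K d ({(k : ℤ) + 1} + t) := by
  rw [effectiveM_add_iff (Multiset.map_univ_coe s) (Multiset.map_univ_coe t)] at h
  rw [effectiveM_add_iff (ι := Unit) (m := fun _ => (k : ℤ) + 1) (by simp)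
    (Multiset.map_univ_coe t)]
  exact h.glue_sum k hk

/-- The degree and the four multiplicities all change by the same amount. Stating this through
differences lets each move of a chain be checked by `ring` and `abel`. -/
theorem EffectiveM.cremona (h : EffectiveM K d s) {s' : Multiset ℤ} (a b c e : ℤ)
    {a' b' c' e' : ℤ} (t : Multiset ℤ) (hs : s = {a} + {b} + {c} + {e} + t)
    (hd : d' = 3 * d - (a + b + c + e)) (ha : a' - a = d' - d) (hb : b' - b = d' - d)
    (hc : c' - c = d' - d) (he : e' - e = d' - d)
    (hs' : s' = {a'} + {b'} + {c'} + {e'} + t) : EffectiveM K d' s' := by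
  have key : ∀ a b c e : ℤ, (Finset.univ : Finset (Fin 4)).val.map ![a, b, c, e] =
      {a} + {b} + {c} + {e} := by
    intro a b c e
    simp [Fin.univ_val_map]
    rfl
  rw [hs, effectiveM_add_iff (key a b c e) (Multiset.map_univ_coe t)] at h
  have h1 := h.cremona_sum
  have h2 : ∑ i, ![a, b, c, e] i = a + b + c + e := by simp [Fin.sum_univ_four]
  rw [h2] at h1
  rw [hs', effectiveM_add_iff (key a' b' c' e') (Multiset.map_univ_coe t)]
  convert h1 using 2
  funext i
  fin_cases i <;> simp <;> omega

theorem EffectiveM.le_of_eight_eq {m : ℤ} (h : EffectiveM K d (8 • {m})) : 2 * m ≤ d := by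
  by_contra hlt
  push Not at hlt
  obtain ⟨e, he⟩ : ∃ e, e = 2 * m - d := ⟨_, rfl⟩
  -- Cremona moves alternate between the two groups of four, always at the larger multiplicities.
  -- The positive defect `e` makes the degree fall quadratically.
  have key : ∀ k : ℕ, EffectiveM K (d - 2 * e * k ^ 2)
      (4 • {m - e * (k * (k - 1))} + 4 • {m - e * (k * (k + 1))}) := by
    intro k
    induction k with
    | zero =>
      convert h using 1
      · simp
      · simp only [CharP.cast_eq_zero, zero_mul, mul_zero, sub_zero]
        abel
    | succ k ih =>
      refine ih.cremona (m - e * (k * (k - 1))) (m - e * (k * (k - 1))) (m - e * (k * (k - 1)))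
        (m - e * (k * (k - 1))) (4 • {m - e * (k * (k + 1))}) (by abel) ?_
        (a' := m - e * (((k + 1 : ℕ) : ℤ) * ((k + 1 : ℕ) + 1)))
        (b' := m - e * (((k + 1 : ℕ) : ℤ) * ((k + 1 : ℕ) + 1)))
        (c' := m - e * (((k + 1 : ℕ) : ℤ) * ((k + 1 : ℕ) + 1)))
        (e' := m - e * (((k + 1 : ℕ) : ℤ) * ((k + 1 : ℕ) + 1))) ?_ ?_ ?_ ?_ ?_
      · push_cast; rw [he]; ring
      · push_cast; ring
      · push_cast; ring
      · push_cast; ring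
      · push_cast; ring
      · have : m - e * (((k + 1 : ℕ) : ℤ) * ((k + 1 : ℕ) - 1)) = m - e * (k * (k + 1)) := by
          push_cast; ring
        rw [this]
        abel
  -- This number of moves is at least `m` and at least 1. As `d < 2 * m` and `e ≥ 1`, the degree
  -- would be negative.
  have h1 := (key (m.toNat + 1)).nonneg
  have h2 : m ≤ ((m.toNat + 1 : ℕ) : ℤ) := by omega
  have h3 : (1 : ℤ) ≤ ((m.toNat + 1 : ℕ) : ℤ) := by omega
  nlinarith

theorem EffectiveM.le_of_nine_eq {p m : ℤ} (h : EffectiveM K d ({p} + 9 • {m})) :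
    p + 3 * m ≤ 2 * d := by
  by_contra hlt
  push Not at hlt
  obtain ⟨e, he⟩ : ∃ e, e = p + 3 * m - 2 * d := ⟨_, rfl⟩
  -- The nine points form three triples. One stage consists of two Cremona moves, each at the
  -- special point and the triple of largest current multiplicity; the third triple then takes the
  -- role of the first.
  have key : ∀ k : ℕ, EffectiveM K (d - 3 * k ^ 2 * e) ({p - 3 * k ^ 2 * e} +
      3 • {m - e * (k ^ 2 - k)} + 3 • {m - e * k ^ 2} + 3 • {m - e * (k ^ 2 + k)}) := by
    intro k
    induction k with
    | zero =>
      convert h using 1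
      · simp
      · simp only [CharP.cast_eq_zero, zero_mul, mul_zero, sub_zero, ne_eq, OfNat.ofNat_ne_zero,
          not_false_eq_true, zero_pow, add_zero]
        abel
    | succ k ih =>
      have h1 := ih.cremona (p - 3 * k ^ 2 * e) (m - e * (k ^ 2 - k)) (m - e * (k ^ 2 - k))
        (m - e * (k ^ 2 - k)) (3 • {m - e * k ^ 2} + 3 • {m - e * (k ^ 2 + k)}) (by abel)
        (d' := d - 3 * k ^ 2 * e - (3 * k + 1) * e)
        (a' := p - 3 * k ^ 2 * e - (3 * k + 1) * e) (b' := m - e * (k + 1) ^ 2)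
        (c' := m - e * (k + 1) ^ 2) (e' := m - e * (k + 1) ^ 2)
        (by rw [he]; ring) (by ring) (by ring) (by ring) (by ring) rfl
      refine h1.cremona (p - 3 * k ^ 2 * e - (3 * k + 1) * e) (m - e * k ^ 2) (m - e * k ^ 2)
        (m - e * k ^ 2) (3 • {m - e * (k + 1) ^ 2} + 3 • {m - e * (k ^ 2 + k)}) (by abel)
        (a' := p - 3 * ((k + 1 : ℕ) : ℤ) ^ 2 * e)
        (b' := m - e * (((k + 1 : ℕ) : ℤ) ^ 2 + (k + 1 : ℕ)))
        (c' := m - e * (((k + 1 : ℕ) : ℤ) ^ 2 + (k + 1 : ℕ)))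
        (e' := m - e * (((k + 1 : ℕ) : ℤ) ^ 2 + (k + 1 : ℕ))) ?_ ?_ ?_ ?_ ?_ ?_
      · push_cast; rw [he]; ring
      · push_cast; ring
      · push_cast; ring
      · push_cast; ring
      · push_cast; ring
      · have h2 : m - e * (((k + 1 : ℕ) : ℤ) ^ 2 - (k + 1 : ℕ)) = m - e * (k ^ 2 + k) := by
          push_cast; ring
        have h3 : m - e * ((k + 1 : ℕ) : ℤ) ^ 2 = m - e * (k + 1) ^ 2 := by push_cast; ring
        rw [h2, h3]
        abel
  have h1 := (key (d.toNat + 1)).nonneg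
  have h2 : d < ((d.toNat + 1 : ℕ) : ℤ) := by omega
  have h3 : (1 : ℤ) ≤ ((d.toNat + 1 : ℕ) : ℤ) := by omega
  nlinarith

omit [Infinite K] in
/-- The average over the rotations of the last `n` points. -/
theorem Effective.rotate {κ : Type*} {n : ℕ} [NeZero n] {a : κ → ℤ} {m : Fin n → ℤ}
    (h : Effective K d (Sum.elim a m)) :
    Effective K (n * d) (Sum.elim (fun k => n * a k) fun _ : Fin n => ∑ i, m i) := by
  have h1 := Effective.sum (Finset.univ : Finset (Fin n)) (d := fun _ => d)
    (m := fun r => Sum.elim a fun i => m (i + r)) fun r _ =>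
      h.comp (Sum.map id fun i => i + r)
        (Sum.map_injective.2 ⟨Function.injective_id, add_left_injective r⟩) (by
          rintro (k | i) <;> simp)
  have h2 : (∑ r : Fin n, Sum.elim a fun i => m (i + r)) =
      Sum.elim (fun k => (n : ℤ) * a k) fun _ : Fin n => ∑ i, m i := by
    funext x
    rw [Finset.sum_apply]
    rcases x with k | i
    · simp
    · exact Fintype.sum_equiv (Equiv.addLeft i) _ _ fun _ => rfl
  rw [h2] at h1
  simpa using h1

/-- Multiplying the forms for all cyclic rotations gives degree `8 * d` and equal multiplicities
`s.sum`. -/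
theorem EffectiveM.sum_le_of_card_eq_eight (h : EffectiveM K d s) (hs : s.card = 8) :
    s.sum ≤ 4 * d := by
  obtain ⟨m, hm⟩ := exists_fin_map s hs
  have h1 : EffectiveM K d (0 + s) := by rwa [zero_add]
  rw [effectiveM_add_iff (ι := Fin 0) (m := Fin.elim0) (by simp) hm] at h1
  have h2 := (effectiveM_add_iff (s := 0) (by simp) (map_univ_const _)).2 (Effective.rotate h1)
  rw [zero_add] at h2
  have h3 := h2.le_of_eight_eq
  have h4 : s.sum = ∑ i, m i := by rw [← hm]; rfl
  push_cast at h3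
  omega

/-- The same averaging, with the special point held fixed: degree and special multiplicity are
multiplied by 9. -/
theorem EffectiveM.sum_le_of_card_eq_nine {p : ℤ} (h : EffectiveM K d ({p} + s))
    (hs : s.card = 9) : 3 * p + s.sum ≤ 6 * d := by
  obtain ⟨m, hm⟩ := exists_fin_map s hs
  rw [effectiveM_add_iff (ι := Unit) (m := fun _ => p) (by simp) hm] at h
  have h2 := (effectiveM_add_iff (s := {((9 : ℕ) : ℤ) * p}) (by simp) (map_univ_const _)).2
    (Effective.rotate h)
  have h3 := h2.le_of_nine_eq
  have h4 : s.sum = ∑ i, m i := by rw [← hm]; rfl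
  push_cast at h3
  omega

end Multisets

/-! ### Cremona chains and the table -/

section Bounds

variable {K : Type*} [Field K] [Infinite K] {d : ℤ}

/-- Points beyond the chosen eight can be discarded, since this only removes conditions. -/
theorem EffectiveM.sum_le_of_eq_add {s t u : Multiset ℤ} (h : EffectiveM K d s) (hs : s = t + u)
    (ht : t.card = 8) : t.sum ≤ 4 * d := by
  subst hs
  exact h.left.sum_le_of_card_eq_eight ht

theorem EffectiveM.four_thirds_le {m : ℤ}
    (h : EffectiveM K d (4 • {m})) :
    4 * m ≤ 3 * d := by
  have h1 :
      EffectiveM K (3 * d - 4 * m)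
      (4 • {2 * d - 3 * m}) :=
    h.cremona m m m m
      0
      (a' := 2 * d - 3 * m) (b' := 2 * d - 3 * m) (c' := 2 * d - 3 * m)
      (e' := 2 * d - 3 * m) (by abel) (by ring) (by ring) (by ring)
      (by ring) (by ring) (by abel)
  have hd := h1.nonneg
  omega

theorem EffectiveM.five_thirds_le {m : ℤ}
    (h : EffectiveM K d (5 • {m})) :
    5 * m ≤ 3 * d := by
  have h1 :
      EffectiveM K (3 * d - 4 * m)
      ({m} + 4 • {2 * d - 3 * m}) :=
    h.cremona m m m m
      ({m})
      (a' := 2 * d - 3 * m) (b' := 2 * d - 3 * m) (c' := 2 * d - 3 * m)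
      (e' := 2 * d - 3 * m) (by abel) (by ring) (by ring) (by ring)
      (by ring) (by ring) (by abel)
  -- The untouched fifth point still has multiplicity `m`, which the new degree must reach;
  -- nonnegativity of the degree would give only the bound for four points.
  have hd := h1.le
  omega

theorem EffectiveM.twelve_sevenths_le {m : ℤ}
    (h : EffectiveM K d (6 • {m})) :
    12 * m ≤ 7 * d := by
  have h1 :
      EffectiveM K (3 * d - 4 * m)
      (2 • {m} + 4 • {2 * d - 3 * m}) :=
    h.cremona m m m m
      (2 • {m})
      (a' := 2 * d - 3 * m) (b' := 2 * d - 3 * m) (c' := 2 * d - 3 * m)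
      (e' := 2 * d - 3 * m) (by abel) (by ring) (by ring) (by ring)
      (by ring) (by ring) (by abel)
  have h2 :
      EffectiveM K (5 * d - 8 * m)
      (4 • {2 * d - 3 * m} + 2 • {4 * d - 7 * m}) :=
    h1.cremona m m (2 * d - 3 * m) (2 * d - 3 * m)
      (2 • {2 * d - 3 * m})
      (a' := 2 * d - 3 * m) (b' := 2 * d - 3 * m) (c' := 4 * d - 7 * m)
      (e' := 4 * d - 7 * m) (by abel) (by ring) (by ring) (by ring)
      (by ring) (by ring) (by abel)
  have h3 :
      EffectiveM K (7 * d - 12 * m)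
      (6 • {4 * d - 7 * m}) :=
    h2.cremona (2 * d - 3 * m) (2 * d - 3 * m) (2 * d - 3 * m) (2 * d - 3 * m)
      (2 • {4 * d - 7 * m})
      (a' := 4 * d - 7 * m) (b' := 4 * d - 7 * m) (c' := 4 * d - 7 * m)
      (e' := 4 * d - 7 * m) (by abel) (by ring) (by ring) (by ring)
      (by ring) (by ring) (by abel)
  have hd := h3.nonneg
  omega

theorem EffectiveM.twentyeight_fifteenths_le {m : ℤ}
    (h : EffectiveM K d (7 • {m})) :
    28 * m ≤ 15 * d := by
  have h1 :
      EffectiveM K (3 * d - 4 * m)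
      (3 • {m} + 4 • {2 * d - 3 * m}) :=
    h.cremona m m m m
      (3 • {m})
      (a' := 2 * d - 3 * m) (b' := 2 * d - 3 * m) (c' := 2 * d - 3 * m)
      (e' := 2 * d - 3 * m) (by abel) (by ring) (by ring) (by ring)
      (by ring) (by ring) (by abel)
  have h2 :
      EffectiveM K (7 * d - 12 * m)
      (3 • {2 * d - 3 * m} + 3 • {4 * d - 7 * m} + {6 * d - 11 * m}) :=
    h1.cremona m m m (2 * d - 3 * m)
      (3 • {2 * d - 3 * m})
      (a' := 4 * d - 7 * m) (b' := 4 * d - 7 * m) (c' := 4 * d - 7 * m)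
      (e' := 6 * d - 11 * m) (by abel) (by ring) (by ring) (by ring)
      (by ring) (by ring) (by abel)
  have h3 :
      EffectiveM K (11 * d - 20 * m)
      (2 • {4 * d - 7 * m} + 4 • {6 * d - 11 * m} + {8 * d - 15 * m}) :=
    h2.cremona (2 * d - 3 * m) (2 * d - 3 * m) (2 * d - 3 * m) (4 * d - 7 * m)
      (2 • {4 * d - 7 * m} + {6 * d - 11 * m})
      (a' := 6 * d - 11 * m) (b' := 6 * d - 11 * m) (c' := 6 * d - 11 * m)
      (e' := 8 * d - 15 * m) (by abel) (by ring) (by ring) (by ring)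
      (by ring) (by ring) (by abel)
  have h4 :
      EffectiveM K (13 * d - 24 * m)
      (4 • {6 * d - 11 * m} + 3 • {8 * d - 15 * m}) :=
    h3.cremona (4 * d - 7 * m) (4 * d - 7 * m) (6 * d - 11 * m) (6 * d - 11 * m)
      (2 • {6 * d - 11 * m} + {8 * d - 15 * m})
      (a' := 6 * d - 11 * m) (b' := 6 * d - 11 * m) (c' := 8 * d - 15 * m)
      (e' := 8 * d - 15 * m) (by abel) (by ring) (by ring) (by ring)
      (by ring) (by ring) (by abel)
  have h5 :
      EffectiveM K (15 * d - 28 * m)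
      (7 • {8 * d - 15 * m}) :=
    h4.cremona (6 * d - 11 * m) (6 * d - 11 * m) (6 * d - 11 * m) (6 * d - 11 * m)
      (3 • {8 * d - 15 * m})
      (a' := 8 * d - 15 * m) (b' := 8 * d - 15 * m) (c' := 8 * d - 15 * m)
      (e' := 8 * d - 15 * m) (by abel) (by ring) (by ring) (by ring)
      (by ring) (by ring) (by abel)
  have hd := h5.nonneg
  omega

/-- The averaged inequality for eight points would give only `13 * m ≤ 2 * d`. Eight Cremona moves
bring the degree to `3 * (19 * d - 126 * m)`, which is sharper. -/
theorem EffectiveM.le_of_five_seven {m : ℤ}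
    (h : EffectiveM K d ({5 * m} + 7 • {3 * m})) :
    126 * m ≤ 19 * d := by
  have h1 :
      EffectiveM K (3 * d - 14 * m)
      ({2 * d - 9 * m} + 4 • {3 * m} + 3 • {2 * d - 11 * m}) :=
    h.cremona (5 * m) (3 * m) (3 * m) (3 * m)
      (4 • {3 * m})
      (a' := 2 * d - 9 * m) (b' := 2 * d - 11 * m) (c' := 2 * d - 11 * m)
      (e' := 2 * d - 11 * m) (by abel) (by ring) (by ring) (by ring)
      (by ring) (by ring) (by abel)
  have h2 :
      EffectiveM K (7 * d - 42 * m)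
      ({3 * m} + {6 * d - 37 * m} + 3 • {2 * d - 11 * m} + 3 • {4 * d - 25 * m}) :=
    h1.cremona (2 * d - 9 * m) (3 * m) (3 * m) (3 * m)
      ({3 * m} + 3 • {2 * d - 11 * m})
      (a' := 6 * d - 37 * m) (b' := 4 * d - 25 * m) (c' := 4 * d - 25 * m)
      (e' := 4 * d - 25 * m) (by abel) (by ring) (by ring) (by ring)
      (by ring) (by ring) (by abel)
  have h3 :
      EffectiveM K (11 * d - 70 * m)
      ({2 * d - 11 * m} + 4 • {4 * d - 25 * m} + {10 * d - 65 * m} + 2 • {6 * d - 39 * m}) :=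
    h2.cremona (3 * m) (6 * d - 37 * m) (2 * d - 11 * m) (2 * d - 11 * m)
      ({2 * d - 11 * m} + 3 • {4 * d - 25 * m})
      (a' := 4 * d - 25 * m) (b' := 10 * d - 65 * m) (c' := 6 * d - 39 * m)
      (e' := 6 * d - 39 * m) (by abel) (by ring) (by ring) (by ring)
      (by ring) (by ring) (by abel)
  have h4 :
      EffectiveM K (19 * d - 124 * m)
      ({4 * d - 25 * m} + 2 • {10 * d - 65 * m} + 2 • {6 * d - 39 * m} + 3 • {12 * d - 79 * m}) :=
    h3.cremona (2 * d - 11 * m) (4 * d - 25 * m) (4 * d - 25 * m) (4 * d - 25 * m)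
      ({4 * d - 25 * m} + {10 * d - 65 * m} + 2 • {6 * d - 39 * m})
      (a' := 10 * d - 65 * m) (b' := 12 * d - 79 * m) (c' := 12 * d - 79 * m)
      (e' := 12 * d - 79 * m) (by abel) (by ring) (by ring) (by ring)
      (by ring) (by ring) (by abel)
  have h5 :
      EffectiveM K (27 * d - 178 * m)
      ({6 * d - 39 * m} + 4 • {12 * d - 79 * m} + 2 • {18 * d - 119 * m} + {14 * d - 93 * m}) :=
    h4.cremona (4 * d - 25 * m) (10 * d - 65 * m) (10 * d - 65 * m) (6 * d - 39 * m)
      ({6 * d - 39 * m} + 3 • {12 * d - 79 * m})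
      (a' := 12 * d - 79 * m) (b' := 18 * d - 119 * m) (c' := 18 * d - 119 * m)
      (e' := 14 * d - 93 * m) (by abel) (by ring) (by ring) (by ring)
      (by ring) (by ring) (by abel)
  have h6 :
      EffectiveM K (39 * d - 258 * m)
      ({12 * d - 79 * m} + 3 • {18 * d - 119 * m} + 3 • {24 * d - 159 * m} + {14 * d - 93 * m}) :=
    h5.cremona (6 * d - 39 * m) (12 * d - 79 * m) (12 * d - 79 * m) (12 * d - 79 * m)
      ({12 * d - 79 * m} + 2 • {18 * d - 119 * m} + {14 * d - 93 * m})
      (a' := 18 * d - 119 * m) (b' := 24 * d - 159 * m) (c' := 24 * d - 159 * m)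
      (e' := 24 * d - 159 * m) (by abel) (by ring) (by ring) (by ring)
      (by ring) (by ring) (by abel)
  have h7 :
      EffectiveM K (51 * d - 338 * m)
      (4 • {24 * d - 159 * m} + 3 • {30 * d - 199 * m} + {14 * d - 93 * m}) :=
    h6.cremona (12 * d - 79 * m) (18 * d - 119 * m) (18 * d - 119 * m) (18 * d - 119 * m)
      (3 • {24 * d - 159 * m} + {14 * d - 93 * m})
      (a' := 24 * d - 159 * m) (b' := 30 * d - 199 * m) (c' := 30 * d - 199 * m)
      (e' := 30 * d - 199 * m) (by abel) (by ring) (by ring) (by ring)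
      (by ring) (by ring) (by abel)
  have h8 :
      EffectiveM K (57 * d - 378 * m)
      (7 • {30 * d - 199 * m} + {14 * d - 93 * m}) :=
    h7.cremona (24 * d - 159 * m) (24 * d - 159 * m) (24 * d - 159 * m) (24 * d - 159 * m)
      (3 • {30 * d - 199 * m} + {14 * d - 93 * m})
      (a' := 30 * d - 199 * m) (b' := 30 * d - 199 * m) (c' := 30 * d - 199 * m)
      (e' := 30 * d - 199 * m) (by abel) (by ring) (by ring) (by ring)
      (by ring) (by ring) (by abel)
  have hd := h8.nonneg
  omega

theorem EffectiveM.le_of_five_nine {m : ℤ}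
    (h : EffectiveM K d ({5 * m} + 9 • {3 * m})) :
    7 * m ≤ d := by
  have hd := h.sum_le_of_card_eq_nine (by simp)
  simp only [Multiset.sum_nsmul, Multiset.sum_singleton, nsmul_eq_mul] at hd
  omega

theorem EffectiveM.le_of_two_eight {m : ℤ}
    (h : EffectiveM K d ({2 * m} + 8 • {m})) :
    22 * m ≤ 9 * d := by
  have h1 :
      EffectiveM K (3 * d - 5 * m)
      ({2 * d - 3 * m} + 5 • {m} + 3 • {2 * d - 4 * m}) :=
    h.cremona (2 * m) m m m
      (5 • {m})
      (a' := 2 * d - 3 * m) (b' := 2 * d - 4 * m) (c' := 2 * d - 4 * m)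
      (e' := 2 * d - 4 * m) (by abel) (by ring) (by ring) (by ring)
      (by ring) (by ring) (by abel)
  have h2 :
      EffectiveM K (7 * d - 15 * m)
      ({6 * d - 13 * m} + 2 • {m} + 3 • {2 * d - 4 * m} + 3 • {4 * d - 9 * m}) :=
    h1.cremona (2 * d - 3 * m) m m m
      (2 • {m} + 3 • {2 * d - 4 * m})
      (a' := 6 * d - 13 * m) (b' := 4 * d - 9 * m) (c' := 4 * d - 9 * m)
      (e' := 4 * d - 9 * m) (by abel) (by ring) (by ring) (by ring)
      (by ring) (by ring) (by abel)
  have h3 :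
      EffectiveM K (13 * d - 30 * m)
      ({12 * d - 28 * m} + 2 • {2 * d - 4 * m} + 3 • {4 * d - 9 * m} + 2 • {6 * d - 14 * m} +
        {8 * d - 19 * m}) :=
    h2.cremona (6 * d - 13 * m) m m (2 * d - 4 * m)
      (2 • {2 * d - 4 * m} + 3 • {4 * d - 9 * m})
      (a' := 12 * d - 28 * m) (b' := 6 * d - 14 * m) (c' := 6 * d - 14 * m)
      (e' := 8 * d - 19 * m) (by abel) (by ring) (by ring) (by ring)
      (by ring) (by ring) (by abel)
  have h4 :
      EffectiveM K (19 * d - 45 * m)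
      ({18 * d - 43 * m} + 2 • {4 * d - 9 * m} + 2 • {6 * d - 14 * m} + 3 • {8 * d - 19 * m} +
        {10 * d - 24 * m}) :=
    h3.cremona (12 * d - 28 * m) (2 * d - 4 * m) (2 * d - 4 * m) (4 * d - 9 * m)
      (2 • {4 * d - 9 * m} + 2 • {6 * d - 14 * m} + {8 * d - 19 * m})
      (a' := 18 * d - 43 * m) (b' := 8 * d - 19 * m) (c' := 8 * d - 19 * m)
      (e' := 10 * d - 24 * m) (by abel) (by ring) (by ring) (by ring)
      (by ring) (by ring) (by abel)
  have h5 :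
      EffectiveM K (25 * d - 60 * m)
      ({6 * d - 14 * m} + {24 * d - 58 * m} + 3 • {8 * d - 19 * m} + 3 • {10 * d - 24 * m} +
        {12 * d - 29 * m}) :=
    h4.cremona (18 * d - 43 * m) (4 * d - 9 * m) (4 * d - 9 * m) (6 * d - 14 * m)
      ({6 * d - 14 * m} + 3 • {8 * d - 19 * m} + {10 * d - 24 * m})
      (a' := 24 * d - 58 * m) (b' := 10 * d - 24 * m) (c' := 10 * d - 24 * m)
      (e' := 12 * d - 29 * m) (by abel) (by ring) (by ring) (by ring)
      (by ring) (by ring) (by abel)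
  have h6 :
      EffectiveM K (29 * d - 70 * m)
      ({8 * d - 19 * m} + 4 • {10 * d - 24 * m} + {28 * d - 68 * m} + 3 • {12 * d - 29 * m}) :=
    h5.cremona (6 * d - 14 * m) (24 * d - 58 * m) (8 * d - 19 * m) (8 * d - 19 * m)
      ({8 * d - 19 * m} + 3 • {10 * d - 24 * m} + {12 * d - 29 * m})
      (a' := 10 * d - 24 * m) (b' := 28 * d - 68 * m) (c' := 12 * d - 29 * m)
      (e' := 12 * d - 29 * m) (by abel) (by ring) (by ring) (by ring)
      (by ring) (by ring) (by abel)
  have h7 :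
      EffectiveM K (49 * d - 119 * m)
      ({10 * d - 24 * m} + 2 • {28 * d - 68 * m} + 3 • {12 * d - 29 * m} + 3 • {30 * d - 73 * m}) :=
    h6.cremona (8 * d - 19 * m) (10 * d - 24 * m) (10 * d - 24 * m) (10 * d - 24 * m)
      ({10 * d - 24 * m} + {28 * d - 68 * m} + 3 • {12 * d - 29 * m})
      (a' := 28 * d - 68 * m) (b' := 30 * d - 73 * m) (c' := 30 * d - 73 * m)
      (e' := 30 * d - 73 * m) (by abel) (by ring) (by ring) (by ring)
      (by ring) (by ring) (by abel)
  have h8 :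
      EffectiveM K (69 * d - 168 * m)
      (2 • {12 * d - 29 * m} + 4 • {30 * d - 73 * m} + 2 • {48 * d - 117 * m} +
        {32 * d - 78 * m}) :=
    h7.cremona (10 * d - 24 * m) (28 * d - 68 * m) (28 * d - 68 * m) (12 * d - 29 * m)
      (2 • {12 * d - 29 * m} + 3 • {30 * d - 73 * m})
      (a' := 30 * d - 73 * m) (b' := 48 * d - 117 * m) (c' := 48 * d - 117 * m)
      (e' := 32 * d - 78 * m) (by abel) (by ring) (by ring) (by ring)
      (by ring) (by ring) (by abel)
  -- The ninth point is discarded here; the inequality for the other eight reads `88 * m ≤ 36 * d`.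
  have hd := h8.sum_le_of_eq_add (t := 2 • {12 * d - 29 * m} + 4 • {30 * d - 73 * m} +
        2 • {48 * d - 117 * m})
    (u := {32 * d - 78 * m}) (by abel) (by simp)
  simp only [Multiset.sum_add, Multiset.sum_nsmul, Multiset.sum_singleton, nsmul_eq_mul] at hd
  omega

theorem EffectiveM.le_of_two_nine {m : ℤ}
    (h : EffectiveM K d ({2 * m} + 9 • {m})) :
    5 * m ≤ 2 * d := by
  have hd := h.sum_le_of_card_eq_nine (by simp)
  simp only [Multiset.sum_nsmul, Multiset.sum_singleton, nsmul_eq_mul] at hd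
  omega

theorem EffectiveM.le_of_five_five_five_six {m : ℤ}
    (h : EffectiveM K d (3 • {5 * m} + 6 • {3 * m})) :
    8 * m ≤ d := by
  have h1 :
      EffectiveM K (3 * d - 18 * m)
      (5 • {3 * m} + 3 • {2 * d - 13 * m} + {2 * d - 15 * m}) :=
    h.cremona (5 * m) (5 * m) (5 * m) (3 * m)
      (5 • {3 * m})
      (a' := 2 * d - 13 * m) (b' := 2 * d - 13 * m) (c' := 2 * d - 13 * m)
      (e' := 2 * d - 15 * m) (by abel) (by ring) (by ring) (by ring)
      (by ring) (by ring) (by abel)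
  have hd := h1.sum_le_of_eq_add (t := 5 • {3 * m} + 3 • {2 * d - 13 * m})
    (u := {2 * d - 15 * m}) (by abel) (by simp)
  simp only [Multiset.sum_add, Multiset.sum_nsmul, Multiset.sum_singleton, nsmul_eq_mul] at hd
  omega

theorem EffectiveM.le_of_two_two_eight {m : ℤ}
    (hm : 0 < m) (h : EffectiveM K d (2 • {2 * m} + 8 • {m})) :
    107 * m ≤ 39 * d := by
  have h1 :
      EffectiveM K (3 * d - 6 * m)
      (2 • {2 * d - 4 * m} + 6 • {m} + 2 • {2 * d - 5 * m}) :=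
    h.cremona (2 * m) (2 * m) m m
      (6 • {m})
      (a' := 2 * d - 4 * m) (b' := 2 * d - 4 * m) (c' := 2 * d - 5 * m)
      (e' := 2 * d - 5 * m) (by abel) (by ring) (by ring) (by ring)
      (by ring) (by ring) (by abel)
  -- This yields `11 * m ≤ 4 * d`. Since 11/4 exceeds 107/39 and `m` is positive, the tabulated
  -- bound follows with room to spare.
  have hd := h1.sum_le_of_eq_add (t := 2 • {2 * d - 4 * m} + 6 • {m})
    (u := 2 • {2 * d - 5 * m}) (by abel) (by simp)
  simp only [Multiset.sum_add, Multiset.sum_nsmul, Multiset.sum_singleton, nsmul_eq_mul] at hd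
  omega

theorem EffectiveM.le_of_two_two_two_six {m : ℤ}
    (h : EffectiveM K d (3 • {2 * m} + 6 • {m})) :
    3 * m ≤ d := by
  have h1 :
      EffectiveM K (3 * d - 7 * m)
      (5 • {m} + 3 • {2 * d - 5 * m} + {2 * d - 6 * m}) :=
    h.cremona (2 * m) (2 * m) (2 * m) m
      (5 • {m})
      (a' := 2 * d - 5 * m) (b' := 2 * d - 5 * m) (c' := 2 * d - 5 * m)
      (e' := 2 * d - 6 * m) (by abel) (by ring) (by ring) (by ring)
      (by ring) (by ring) (by abel)
  have hd := h1.sum_le_of_eq_add (t := 5 • {m} + 3 • {2 * d - 5 * m})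
    (u := {2 * d - 6 * m}) (by abel) (by simp)
  simp only [Multiset.sum_add, Multiset.sum_nsmul, Multiset.sum_singleton, nsmul_eq_mul] at hd
  omega

theorem EffectiveM.le_of_two_two_two_five_six {m : ℤ}
    (h : EffectiveM K d (3 • {6 * m} + {5 * m} + 6 • {3 * m})) :
    67 * m ≤ 7 * d := by
  have h1 :
      EffectiveM K (3 * d - 23 * m)
      (6 • {3 * m} + 3 • {2 * d - 17 * m} + {2 * d - 18 * m}) :=
    h.cremona (6 * m) (6 * m) (6 * m) (5 * m)
      (6 • {3 * m})
      (a' := 2 * d - 17 * m) (b' := 2 * d - 17 * m) (c' := 2 * d - 17 * m)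
      (e' := 2 * d - 18 * m) (by abel) (by ring) (by ring) (by ring)
      (by ring) (by ring) (by abel)
  have h2 :
      EffectiveM K (9 * d - 81 * m)
      (2 • {3 * m} + 4 • {6 * d - 55 * m} + 3 • {2 * d - 17 * m} + {2 * d - 18 * m}) :=
    h1.cremona (3 * m) (3 * m) (3 * m) (3 * m)
      (2 • {3 * m} + 3 • {2 * d - 17 * m} + {2 * d - 18 * m})
      (a' := 6 * d - 55 * m) (b' := 6 * d - 55 * m) (c' := 6 * d - 55 * m)
      (e' := 6 * d - 55 * m) (by abel) (by ring) (by ring) (by ring)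
      (by ring) (by ring) (by abel)
  have h3 :
      EffectiveM K (15 * d - 139 * m)
      (4 • {6 * d - 55 * m} + 3 • {2 * d - 17 * m} + 2 • {12 * d - 113 * m} + {2 * d - 18 * m}) :=
    h2.cremona (3 * m) (3 * m) (6 * d - 55 * m) (6 * d - 55 * m)
      (2 • {6 * d - 55 * m} + 3 • {2 * d - 17 * m} + {2 * d - 18 * m})
      (a' := 6 * d - 55 * m) (b' := 6 * d - 55 * m) (c' := 12 * d - 113 * m)
      (e' := 12 * d - 113 * m) (by abel) (by ring) (by ring) (by ring)
      (by ring) (by ring) (by abel)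
  have h4 :
      EffectiveM K (21 * d - 197 * m)
      (3 • {2 * d - 17 * m} + 6 • {12 * d - 113 * m} + {2 * d - 18 * m}) :=
    h3.cremona (6 * d - 55 * m) (6 * d - 55 * m) (6 * d - 55 * m) (6 * d - 55 * m)
      (3 • {2 * d - 17 * m} + 2 • {12 * d - 113 * m} + {2 * d - 18 * m})
      (a' := 12 * d - 113 * m) (b' := 12 * d - 113 * m) (c' := 12 * d - 113 * m)
      (e' := 12 * d - 113 * m) (by abel) (by ring) (by ring) (by ring)
      (by ring) (by ring) (by abel)
  have h5 :
      EffectiveM K (45 * d - 427 * m)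
      (5 • {12 * d - 113 * m} + 3 • {26 * d - 247 * m} + {36 * d - 343 * m} + {2 * d - 18 * m}) :=
    h4.cremona (2 * d - 17 * m) (2 * d - 17 * m) (2 * d - 17 * m) (12 * d - 113 * m)
      (5 • {12 * d - 113 * m} + {2 * d - 18 * m})
      (a' := 26 * d - 247 * m) (b' := 26 * d - 247 * m) (c' := 26 * d - 247 * m)
      (e' := 36 * d - 343 * m) (by abel) (by ring) (by ring) (by ring)
      (by ring) (by ring) (by abel)
  -- Two of the ten points are discarded; the inequality for the rest is 6 times the claimed one.
  have hd := h5.sum_le_of_eq_add (t := 5 • {12 * d - 113 * m} + 3 • {26 * d - 247 * m})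
    (u := {36 * d - 343 * m} + {2 * d - 18 * m}) (by abel) (by simp)
  simp only [Multiset.sum_add, Multiset.sum_nsmul, Multiset.sum_singleton, nsmul_eq_mul] at hd
  omega


/-- Five points of multiplicity `3 m` degenerate to a point of multiplicity `5 m`. -/
theorem EffectiveM.glue_five {m : ℤ} (hm : 0 < m) {s : Multiset ℤ} (h : EffectiveM K d s)
    (t : Multiset ℤ) (hs : s = 5 • {3 * m} + t) : EffectiveM K d ({5 * m} + t) := by
  subst hs
  -- The largest degree excluded by the bound 5/3 for multiplicity `3 * m` is `5 * m - 1`; the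
  -- collision multiplicity is one more.
  have h1 := h.glue (k := (5 * m - 1).toNat) fun hk => by
    have := hk.five_thirds_le
    omega
  have h2 : (((5 * m - 1).toNat : ℕ) : ℤ) + 1 = 5 * m := by omega
  rwa [h2] at h1

/-- Eight points of multiplicity `m` degenerate to a point of multiplicity `2 m`. -/
theorem EffectiveM.glue_eight {m : ℤ} (hm : 0 < m) {s : Multiset ℤ} (h : EffectiveM K d s)
    (t : Multiset ℤ) (hs : s = 8 • {m} + t) : EffectiveM K d ({2 * m} + t) := by
  subst hs
  have h1 := h.glue (k := (2 * m - 1).toNat) fun hk => by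
    have := hk.le_of_eight_eq
    omega
  have h2 : (((2 * m - 1).toNat : ℕ) : ℤ) + 1 = 2 * m := by omega
  rwa [h2] at h1

/-- The tabulated bounds for forms with `n` general points of equal multiplicity. -/
theorem EffectiveM.table_le {n : ℕ} {β : ℚ} (hβ : b n = some β) {m : ℤ} (hm : 0 < m)
    (h : EffectiveM K d (n • {m})) : β * m ≤ d := by
  -- Tripling makes the bound for five colliding points integral: 5/3 of `3 * m` is `5 * m`. The
  -- factor 3 in the degree is divided out at the end.
  have h3 : EffectiveM K (3 * d) (n • {3 * m}) := h.nsmul_nsmul_singleton 3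
  have hm3 : 0 < 3 * m := by omega
  unfold b at hβ
  split at hβ <;> cases hβ
  · have h1 := EffectiveM.le (t := 0) (by convert h using 1; abel)
    rw [one_mul]; exact_mod_cast h1
  · have h1 := EffectiveM.le (t := {m}) (by convert h using 1; abel)
    rw [one_mul]; exact_mod_cast h1
  · have h1 := EffectiveM.le (t := {m} + {m}) (by convert h using 1; abel)
    rw [one_mul]; exact_mod_cast h1
  · have h1 : (4 : ℚ) * m ≤ 3 * d := by exact_mod_cast h.four_thirds_le
    linarith
  · have h1 : (5 : ℚ) * m ≤ 3 * d := by exact_mod_cast h.five_thirds_le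
    linarith
  · have h1 : (12 : ℚ) * m ≤ 7 * d := by exact_mod_cast h.twelve_sevenths_le
    linarith
  · have h1 : (28 : ℚ) * m ≤ 15 * d := by exact_mod_cast h.twentyeight_fifteenths_le
    linarith
  · have h1 : (2 : ℚ) * m ≤ d := by exact_mod_cast h.le_of_eight_eq
    linarith
  · have h1 : (126 : ℚ) * m ≤ 19 * (3 * d) := by
      exact_mod_cast (h3.glue_five hm (7 • {3 * m}) (by abel)).le_of_five_seven
    linarith
  · have h1 : (7 : ℚ) * m ≤ 3 * d := by
      exact_mod_cast (h3.glue_five hm (9 • {3 * m}) (by abel)).le_of_five_nine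
    linarith
  · have h1 : (22 : ℚ) * m ≤ 9 * d := by
      exact_mod_cast (h.glue_eight hm (8 • {m}) (by abel)).le_of_two_eight
    linarith
  · have h1 : (5 : ℚ) * m ≤ 2 * d := by
      exact_mod_cast (h.glue_eight hm (9 • {m}) (by abel)).le_of_two_nine
    linarith
  · have h1 := h3.glue_five hm (16 • {3 * m}) (by abel)
    have h2 := h1.glue_five hm ({5 * m} + 11 • {3 * m}) (by abel)
    have h4 := h2.glue_five hm (2 • {5 * m} + 6 • {3 * m}) (by abel)
    have h5 : (8 : ℚ) * m ≤ 3 * d := by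
      exact_mod_cast EffectiveM.le_of_five_five_five_six (by convert h4 using 1; abel)
    linarith
  · have h1 := h.glue_eight hm (16 • {m}) (by abel)
    have h2 := h1.glue_eight hm ({2 * m} + 8 • {m}) (by abel)
    have h5 : (107 : ℚ) * m ≤ 39 * d := by
      exact_mod_cast EffectiveM.le_of_two_two_eight hm (by convert h2 using 1; abel)
    linarith
  · have h1 := h.glue_eight hm (22 • {m}) (by abel)
    have h2 := h1.glue_eight hm ({2 * m} + 14 • {m}) (by abel)
    have h4 := h2.glue_eight hm (2 • {2 * m} + 6 • {m}) (by abel)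
    have h5 : (3 : ℚ) * m ≤ d := by
      exact_mod_cast EffectiveM.le_of_two_two_two_six (by convert h4 using 1; abel)
    linarith
  · have h1 := h3.glue_eight hm3 (27 • {3 * m}) (by abel)
    have h2 := h1.glue_eight hm3 ({2 * (3 * m)} + 19 • {3 * m}) (by abel)
    have h4 := h2.glue_eight hm3 (2 • {2 * (3 * m)} + 11 • {3 * m}) (by abel)
    have h6 := h4.glue_five hm (3 • {2 * (3 * m)} + 6 • {3 * m}) (by abel)
    have h7 : 2 * (3 * m) = 6 * m := by ring
    rw [h7] at h6
    have h5 : (67 : ℚ) * m ≤ 7 * (3 * d) := by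
      exact_mod_cast EffectiveM.le_of_two_two_two_five_six (by convert h6 using 1; abel)
    linarith

end Bounds

/-! ### Symbolic powers of an intersection of incomparable primes -/

section SymbolicPower

variable {R ι : Type*} [CommRing R]

/-- The annihilator of the class of `r` is the intersection of those `P i` that do not contain `r`,
so it is already radical. -/
theorem mem_radical_colon_iff {P : ι → Ideal R} (hP : ∀ i, (P i).IsPrime) (r a : R) :
    a ∈ ((⊥ : Submodule R (R ⧸ ⨅ i, P i)).colon {Ideal.Quotient.mk (⨅ i, P i) r}).radical ↔
      ∀ i, r ∈ P i ∨ a ∈ P i := by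
  have h1 : ∀ b : R, b ∈ (⊥ : Submodule R (R ⧸ ⨅ i, P i)).colon {Ideal.Quotient.mk (⨅ i, P i) r} ↔
      ∀ i, b * r ∈ P i := by
    intro b
    rw [Submodule.mem_colon_singleton, Submodule.mem_bot, ← Ideal.mem_iInf,
      ← Ideal.Quotient.eq_zero_iff_mem, map_mul]
    rfl
  rw [Ideal.mem_radical_iff]
  simp only [h1]
  constructor
  · rintro ⟨k, hk⟩ i
    exact ((hP i).mem_or_mem (hk i)).symm.imp id fun h => (hP i).mem_of_pow_mem _ h
  · intro h
    refine ⟨1, fun i => ?_⟩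
    rw [pow_one]
    exact (h i).elim (Ideal.mul_mem_left _ _) (Ideal.mul_mem_right _ _)

theorem exists_mem_of_ne_of_notMem [Finite ι] {P : ι → Ideal R} (hP : ∀ i, (P i).IsPrime)
    (hinc : ∀ i j, P i ≤ P j → P i = P j) (i : ι) :
    ∃ r, (∀ j, P j ≠ P i → r ∈ P j) ∧ r ∉ P i := by
  classical
  have := Fintype.ofFinite ι
  have h1 : ¬ (Finset.univ.filter fun j => P j ≠ P i).inf P ≤ P i := by
    intro h
    obtain ⟨j, hj, hle⟩ := (Ideal.IsPrime.inf_le' (hP i)).1 h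
    exact (Finset.mem_filter.1 hj).2 (hinc j i hle)
  obtain ⟨r, hr, hri⟩ := SetLike.not_le_iff_exists.1 h1
  exact ⟨r, fun j hj => Finset.inf_le (f := P) (b := j) (by simpa using hj) hr, hri⟩

/-- The associated primes of an intersection of pairwise incomparable primes. -/
theorem associatedPrimes_quotient_iInf [Finite ι] {P : ι → Ideal R} (hP : ∀ i, (P i).IsPrime)
    (hinc : ∀ i j, P i ≤ P j → P i = P j) :
    associatedPrimes R (R ⧸ ⨅ i, P i) = Set.range P := by
  classical
  have := Fintype.ofFinite ι
  ext p
  constructor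
  · rintro ⟨hp, x, hx⟩
    obtain ⟨r, rfl⟩ := Ideal.Quotient.mk_surjective x
    have hmem : ∀ a, a ∈ p ↔ ∀ i, r ∈ P i ∨ a ∈ P i := fun a => by
      rw [hx, mem_radical_colon_iff hP]
    have h1 : (Finset.univ.filter fun i => r ∉ P i).inf P ≤ p := by
      intro a ha
      rw [hmem]
      intro i
      by_cases hi : r ∈ P i
      · exact Or.inl hi
      · exact Or.inr (Finset.inf_le (f := P) (b := i) (by simpa using hi) ha)
    obtain ⟨i, hi, hle⟩ := (Ideal.IsPrime.inf_le' hp).1 h1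
    refine ⟨i, le_antisymm hle fun a ha => ?_⟩
    exact ((hmem a).1 ha i).resolve_left (by simpa using hi)
  · rintro ⟨i, rfl⟩
    obtain ⟨r, hr, hri⟩ := exists_mem_of_ne_of_notMem hP hinc i
    refine ⟨hP i, Ideal.Quotient.mk _ r, ?_⟩
    ext a
    rw [mem_radical_colon_iff hP]
    constructor
    · intro ha j
      by_cases hj : P j = P i
      · exact Or.inr (hj ▸ ha)
      · exact Or.inl (hr j hj)
    · intro h
      exact (h i).resolve_left hri

/-- An element lying in the other primes but not in `P i` becomes a unit in the localization, so
only `P i` survives there. -/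
theorem map_iInf_eq_map [Finite ι] {P : ι → Ideal R} (hP : ∀ i, (P i).IsPrime)
    (hinc : ∀ i j, P i ≤ P j → P i = P j) (i : ι) :
    (⨅ i, P i).map (algebraMap R (Localization.AtPrime (P i))) =
      (P i).map (algebraMap R (Localization.AtPrime (P i))) := by
  refine le_antisymm (Ideal.map_mono (iInf_le _ _)) (Ideal.map_le_iff_le_comap.2 fun a ha => ?_)
  obtain ⟨r, hr, hri⟩ := exists_mem_of_ne_of_notMem hP hinc i
  have h1 : r * a ∈ ⨅ i, P i := by
    rw [Ideal.mem_iInf]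
    intro j
    by_cases hj : P j = P i
    · exact Ideal.mul_mem_left _ _ (hj ▸ ha)
    · exact Ideal.mul_mem_right _ _ (hr j hj)
  have h2 : IsUnit (algebraMap R (Localization.AtPrime (P i)) r) :=
    IsLocalization.map_units (M := (P i).primeCompl) _ ⟨r, hri⟩
  have h3 := Ideal.mem_map_of_mem (algebraMap R (Localization.AtPrime (P i))) h1
  rw [map_mul] at h3
  exact (Ideal.unit_mul_mem_iff_mem _ h2).1 h3

/-- The symbolic powers of an intersection of pairwise incomparable primes. -/
theorem mem_symbolicPower_iInf_iff [Finite ι] {P : ι → Ideal R} (hP : ∀ i, (P i).IsPrime)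
    (hinc : ∀ i j, P i ≤ P j → P i = P j) (m : ℕ) (f : R) :
    f ∈ symbolicPower (⨅ i, P i) m ↔ ∀ i,
      algebraMap R (Localization.AtPrime (P i)) f ∈
        (P i).map (algebraMap R (Localization.AtPrime (P i))) ^ m := by
  simp only [symbolicPower, Submodule.mem_iInf, Ideal.mem_comap]
  have h := associatedPrimes_quotient_iInf hP hinc
  constructor
  · intro hf i
    rw [← map_iInf_eq_map hP hinc, ← Ideal.map_pow]
    exact hf (P i) (h ▸ Set.mem_range_self i)
  · intro hf p hp
    obtain ⟨i, rfl⟩ : p ∈ Set.range P := h ▸ hp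
    rw [Ideal.map_pow, map_iInf_eq_map hP hinc]
    exact hf i

end SymbolicPower

/-! ### Ideals of points and multiplicities of forms -/

section PointIdeal

variable {K : Type*} [Field K] {N n : ℕ}

/-- The restriction of polynomials to the line spanned by `v`. -/
def restrictLine (v : Fin (N + 1) → K) : Coord K N →ₐ[K] Polynomial K :=
  aeval fun i => Polynomial.X * Polynomial.C (v i)

theorem restrictLine_of_isHomogeneous (v : Fin (N + 1) → K) {f : Coord K N} {d : ℕ}
    (hf : f.IsHomogeneous d) :
    restrictLine v f = Polynomial.X ^ d * Polynomial.C (eval v f) := by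
  rw [restrictLine, aeval_mul_of_isHomogeneous hf]
  congr 1
  have : aeval (fun i => Polynomial.C (v i)) f = algebraMap K (Polynomial K) (aeval v f) := by
    rw [← aeval_algebraMap_apply]; rfl
  rw [this]
  rfl

theorem eval_restrictLine (v : Fin (N + 1) → K) (c : K) (f : Coord K N) :
    (restrictLine v f).eval c = eval (c • v) f := by
  have : (Polynomial.aeval c).comp (restrictLine v) = (aeval (c • v) : Coord K N →ₐ[K] K) := by
    ext i
    simp [restrictLine]
    ring
  have h1 := DFunLike.congr_fun this f
  rw [AlgHom.comp_apply, Polynomial.coe_aeval_eq_eval] at h1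
  exact h1

/-- On the line through `p.rep`, the component of degree `d` restricts to its value times `X ^ d`,
so a restriction vanishes exactly when all components vanish at the point. This also shows
primality. -/
theorem pointIdeal_eq_ker (p : Pt K N) : pointIdeal p = RingHom.ker (restrictLine p.rep) := by
  apply le_antisymm
  · rw [pointIdeal, Ideal.span_le]
    rintro f ⟨⟨d, hd⟩, hf⟩
    change restrictLine p.rep f = 0
    rw [restrictLine_of_isHomogeneous _ hd, hf, map_zero, mul_zero]
  · intro f hf
    have hf : restrictLine p.rep f = 0 := hf
    have h1 : ∀ d, eval p.rep (homogeneousComponent d f) = 0 := by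
      intro d
      rw [← sum_homogeneousComponent f, map_sum] at hf
      simp only [restrictLine_of_isHomogeneous _ (homogeneousComponent_isHomogeneous _ f)] at hf
      have h2 := congrArg (Polynomial.coeff · d) hf
      simp only [Polynomial.finsetSum_coeff, Polynomial.coeff_zero, mul_comm (Polynomial.X ^ _),
        Polynomial.coeff_C_mul_X_pow] at h2
      rw [Finset.sum_ite_eq] at h2
      split_ifs at h2 with hd
      · exact h2
      · rw [homogeneousComponent_eq_zero, map_zero]
        simpa using hd
    rw [← sum_homogeneousComponent f]
    exact Ideal.sum_mem _ fun d _ =>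
      Ideal.subset_span ⟨⟨d, homogeneousComponent_isHomogeneous _ _⟩, h1 d⟩

theorem pointIdeal_isPrime (p : Pt K N) : (pointIdeal p).IsPrime := by
  rw [pointIdeal_eq_ker]
  exact RingHom.ker_isPrime _

theorem minor_mem_pointIdeal (p : Pt K N) (i j : Fin (N + 1)) :
    C (p.rep j) * X i - C (p.rep i) * X j ∈ pointIdeal p := by
  refine Ideal.subset_span ⟨⟨1, (isHomogeneous_C_mul_X _ _).sub (isHomogeneous_C_mul_X _ _)⟩, ?_⟩
  simp [mul_comm]

theorem eval_rep_eq_zero {p : Pt K N} {f : Coord K N} (hf : f ∈ pointIdeal p) (c : K) :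
    eval (c • p.rep) f = 0 := by
  rw [pointIdeal_eq_ker] at hf
  have hf : restrictLine p.rep f = 0 := hf
  rw [← eval_restrictLine, hf, Polynomial.eval_zero]

theorem exists_rep_ne_zero (p : Pt K N) : ∃ j, p.rep j ≠ 0 :=
  Function.ne_iff.1 p.rep_nonzero

theorem eq_of_pointIdeal_le {p q : Pt K N} (h : pointIdeal p ≤ pointIdeal q) : p = q := by
  obtain ⟨j, hj⟩ := exists_rep_ne_zero p
  have h1 : ∀ i, p.rep j * q.rep i = p.rep i * q.rep j := by
    intro i
    have := eval_rep_eq_zero (h (minor_mem_pointIdeal p i j)) 1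
    simpa [sub_eq_zero] using this
  rw [← p.mk_rep, ← q.mk_rep, eq_comm, Projectivization.mk_eq_mk_iff']
  refine ⟨q.rep j / p.rep j, ?_⟩
  funext i
  have := h1 i
  simp only [Pi.smul_apply, smul_eq_mul]
  field_simp
  linear_combination -this

theorem mem_map_pointIdeal_pow_iff [Infinite K] (p : Pt K N) [hp : (pointIdeal p).IsPrime] (m : ℕ)
    {f : Coord K N} {d : ℕ} (hf : f.IsHomogeneous d) :
    algebraMap _ (Localization.AtPrime (pointIdeal p)) f ∈
      (pointIdeal p).map (algebraMap _ (Localization.AtPrime (pointIdeal p))) ^ m ↔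
        HasMult m p.rep f := by
  constructor
  · intro h
    rw [← Ideal.map_pow, IsLocalization.mem_map_algebraMap_iff (pointIdeal p).primeCompl] at h
    obtain ⟨⟨a, s⟩, has⟩ := h
    rw [← map_mul] at has
    have h1 : f * s = a :=
      IsLocalization.injective (Localization.AtPrime (pointIdeal p)) (pointIdeal p).primeCompl_le_nonZeroDivisors has
    have hs : restrictLine p.rep s ≠ 0 := by
      intro h0
      have h2 : (s : Coord K N) ∈ RingHom.ker (restrictLine p.rep) := h0
      rw [← pointIdeal_eq_ker] at h2
      exact s.2 h2
    -- The denominator `s` need not be homogeneous and may vanish at `p.rep` itself; it is nonzero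
    -- somewhere on the line. The factor `X` forces `c ≠ 0`, so the form has the same multiplicity
    -- there.
    obtain ⟨c, hc⟩ : ∃ c, (Polynomial.X * restrictLine p.rep s).eval c ≠ 0 := by
      by_contra hall
      push Not at hall
      exact mul_ne_zero Polynomial.X_ne_zero hs
        (Polynomial.funext fun c => by rw [hall c, Polynomial.eval_zero])
    rw [Polynomial.eval_mul, Polynomial.eval_X, eval_restrictLine] at hc
    rw [← hasMult_smul_iff hf (left_ne_zero_of_mul hc)]
    refine HasMult.of_mul_left (u := s) ?_ (right_ne_zero_of_mul hc)
    rw [mul_comm, h1]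
    exact hasMult_of_mem_pow (fun g hg => eval_rep_eq_zero hg c) a.2
  · intro h
    obtain ⟨j, hj⟩ := exists_rep_ne_zero p
    set L := Localization.AtPrime (pointIdeal p)
    set φ : Coord K N →+* L := algebraMap (Coord K N) L with hφ
    -- Dividing the coordinates by this unit `u` normalizes the point: each `X i / u` is congruent
    -- to `p.rep i` modulo the point ideal. Then Taylor expansion applies to `f(X / u)`, and `f = u
    -- ^ d * f(X / u)`.
    have hu : IsUnit (φ (C (p.rep j)⁻¹ * X j)) := by
      refine IsLocalization.map_units (M := (pointIdeal p).primeCompl) _ ⟨C (p.rep j)⁻¹ * X j, ?_⟩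
      intro hmem
      have := eval_rep_eq_zero hmem 1
      simp [hj] at this
    obtain ⟨u, hu⟩ := hu
    have hx : ∀ i, (u : L) * (↑u⁻¹ * φ (X i)) =
        φ (X i) := fun i => by
      rw [← mul_assoc, u.mul_inv, one_mul]
    have h1 := h.aeval_mem (B := L) ((pointIdeal p).map (φ))
      (fun i => ↑u⁻¹ * φ (X i)) (by
        intro i
        have h2 : ↑u⁻¹ * φ (X i) - algebraMap K L (p.rep i) =
            ↑u⁻¹ * φ (C (p.rep j)⁻¹) *
              φ (C (p.rep j) * X i - C (p.rep i) * X j) := by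
          have h3 : φ (C (p.rep j)⁻¹) * φ (C (p.rep j)) = 1 := by
            rw [← map_mul, ← C_mul, inv_mul_cancel₀ hj, C_1, map_one]
          have h4 : algebraMap K L (p.rep i) = φ (C (p.rep i)) := rfl
          have h5 := u.inv_mul
          rw [hu, map_mul] at h5
          rw [h4, map_sub, map_mul, map_mul]
          linear_combination (-(↑u⁻¹ * φ (X i))) * h3 +
            φ (C (p.rep i)) * h5
        rw [h2]
        exact Ideal.mul_mem_left _ _ (Ideal.mem_map_of_mem _ (minor_mem_pointIdeal p i j)))
    have h6 : φ f =
        (u : L) ^ d * aeval (fun i => ↑u⁻¹ * φ (X i)) f := by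
      rw [← aeval_mul_of_isHomogeneous hf]
      simp only [hx]
      have : (aeval fun i => φ (X i)) = IsScalarTower.toAlgHom K (Coord K N) L := by
        ext i
        rw [aeval_X, hφ]
        rfl
      rw [this]
      rfl
    rw [h6]
    exact Ideal.mul_mem_left _ _ h1

/-- The forms in a symbolic power of the ideal of finitely many points. -/
theorem mem_symbolicPower_pointsIdeal_iff [Infinite K] (p : Fin n → Pt K N) (m : ℕ)
    {f : Coord K N} {d : ℕ} (hf : f.IsHomogeneous d) :
    f ∈ symbolicPower (pointsIdeal p) m ↔ ∀ i, HasMult m (p i).rep f := by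
  have hP := fun i => pointIdeal_isPrime (p i)
  rw [pointsIdeal, mem_symbolicPower_iInf_iff hP fun i j h => by rw [eq_of_pointIdeal_le h]]
  exact forall_congr' fun i => mem_map_pointIdeal_pow_iff (p i) m hf

theorem alpha_symbolicPower_pointsIdeal [Infinite K] {v : Fin n → Fin (N + 1) → K}
    (hv : ∀ i, v i ≠ 0) (m : ℕ) :
    alpha (symbolicPower (pointsIdeal fun i => Projectivization.mk K (v i) (hv i)) m) =
      sInf {t | HasForm t (fun _ => m) v} := by
  rw [alpha]
  congr 1
  ext t
  have key : ∀ f : Coord K N, f.IsHomogeneous t →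
      (f ∈ symbolicPower (pointsIdeal fun i => Projectivization.mk K (v i) (hv i)) m ↔
        ∀ i, HasMult m (v i) f) := by
    intro f hf
    rw [mem_symbolicPower_pointsIdeal_iff _ _ hf]
    refine forall_congr' fun i => ?_
    obtain ⟨a, ha⟩ := Projectivization.exists_smul_eq_mk_rep K (v i) (hv i)
    rw [← ha]
    exact hasMult_smul_iff hf a.ne_zero
  constructor
  · rintro ⟨f, hfm, hf0, hft⟩
    exact ⟨f, hf0, hft, (key f hft).1 hfm⟩
  · rintro ⟨f, hf0, hft, hfm⟩
    exact ⟨f, (key f hft).2 hfm, hf0, hft⟩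

end PointIdeal

/-! ### Generic points, general points and the limit -/

section Generic

theorem HasForm.map {σ ι A B : Type*} [CommRing A] [CommRing B] {d : ℕ} {m : ι → ℕ}
    {v : ι → σ → A} (h : HasForm d m v) {φ : A →+* B} (hφ : Function.Injective φ) :
    HasForm d m fun i => φ ∘ v i := by
  obtain ⟨f, hf0, hfd, hf⟩ := h
  exact ⟨MvPolynomial.map φ f, by rwa [Ne, map_eq_zero_iff _ (map_injective φ hφ)], hfd.map φ,
    fun i => (hf i).map φ⟩

theorem HasForm.mul {σ ι A : Type*} [CommRing A] [IsDomain A] {d d' : ℕ} {m m' : ι → ℕ}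
    {v : ι → σ → A} (h : HasForm d m v) (h' : HasForm d' m' v) :
    HasForm (d + d') (fun i => m i + m' i) v := by
  obtain ⟨f, hf0, hfd, hf⟩ := h
  obtain ⟨g, hg0, hgd, hg⟩ := h'
  exact ⟨f * g, mul_ne_zero hf0 hg0, hfd.mul hgd, fun i => (hf i).mul (hg i)⟩

variable (K : Type*) [Field K] (n : ℕ)

/-- A plane through each point, with the product raised to the power `m`. This makes the infimum in
`genericAlpha` an attained minimum. -/
theorem exists_hasForm_genericVec (m : ℕ) :
    ∃ t, HasForm t (fun _ => m) (genericVec K 3 n) := by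
  let v := genericVec K 3 n
  have hv : ∀ i, v i 0 ≠ 0 := fun i h0 => X_ne_zero (R := K) (i, (0 : Fin 4))
    ((IsFractionRing.to_map_eq_zero_iff (K := GenericField K 3 n)).1 h0)
  let ℓ : Fin n → MvPolynomial (Fin 4) (GenericField K 3 n) :=
    fun i => C (v i 1) * X 0 - C (v i 0) * X 1
  have hℓ : ∀ i, ℓ i ≠ 0 := by
    intro i h0
    have h1 := congrArg (eval fun j : Fin 4 => if j = 1 then (1 : GenericField K 3 n) else 0) h0
    simp [ℓ] at h1
    exact hv i h1
  have hm : ∀ i, HasMult 1 (v i) (ℓ i) := fun i =>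
    hasMult_of_mem_pow (I := RingHom.ker (eval (v i))) (fun g hg => hg) (by
      rw [pow_one, RingHom.mem_ker]
      simp only [ℓ, map_sub, map_mul, eval_C, eval_X]
      ring)
  refine ⟨n * m, (∏ i, ℓ i) ^ m, pow_ne_zero _ (Finset.prod_ne_zero_iff.2 fun i _ => hℓ i), ?_,
    fun i => ?_⟩
  · refine IsHomogeneous.pow ?_ m
    have := IsHomogeneous.prod Finset.univ ℓ (fun _ => 1) fun i _ =>
      (isHomogeneous_C_mul_X _ _).sub (isHomogeneous_C_mul_X _ _)
    simpa using this
  · have h1 : HasMult 1 (v i) (∏ i, ℓ i) := by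
      rw [← Finset.prod_erase_mul _ _ (Finset.mem_univ i)]
      exact (hm i).mul_left _
    simpa using h1.pow m

/-- The least degree of a form with multiplicity `m` at `n` generic points of `ℙ³`. -/
def genericAlpha (m : ℕ) : ℕ :=
  sInf {t | HasForm t (fun _ => m) (genericVec K 3 n)}

theorem hasForm_genericAlpha (m : ℕ) :
    HasForm (genericAlpha K n m) (fun _ => m) (genericVec K 3 n) :=
  Nat.sInf_mem (exists_hasForm_genericVec K n m)

theorem not_hasForm_of_lt_genericAlpha {m t : ℕ} (ht : t < genericAlpha K n m) :
    ¬ HasForm t (fun _ => m) (genericVec K 3 n) :=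
  Nat.notMem_of_lt_sInf ht

variable {K n}

/-- Forms for the generic points specialize to all tuples of points. -/
theorem HasForm.of_generic {d : ℕ} {m : Fin n → ℕ} (h : HasForm d m (genericVec K 3 n))
    (v : Fin n → Fin 4 → K) : HasForm d m v := by
  by_contra hv
  obtain ⟨D, hD, hD'⟩ := exists_nonvanishing_of_not_hasForm (d := d) (m := m)
    (v := fun i j => (X (i, j) : MvPolynomial (Fin n × Fin 4) K))
    (aeval fun p : Fin n × Fin 4 => v p.1 p.2) (by
      convert hv using 3 with i
      funext j
      simp)
  have hD0 : D ≠ 0 := by rintro rfl; simp at hD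
  refine hD' (GenericField K 3 n) (algebraMap _ _) ?_ h
  rwa [Ne, IsFractionRing.to_map_eq_zero_iff]

theorem subadditive_genericAlpha : Subadditive fun m => (genericAlpha K n m : ℝ) := by
  intro m k
  have h : genericAlpha K n (m + k) ≤ genericAlpha K n m + genericAlpha K n k :=
    Nat.sInf_le ((hasForm_genericAlpha K n m).mul (hasForm_genericAlpha K n k))
  simpa only [← Nat.cast_add, Nat.cast_le] using h

variable [Infinite K]

theorem alpha_genericPoints (m : ℕ) :
    alpha (symbolicPower (pointsIdeal (genericPoints K 3 n)) m) = genericAlpha K n m := by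
  have : Infinite (GenericField K 3 n) :=
    Infinite.of_injective _ (algebraMap K (GenericField K 3 n)).injective
  exact alpha_symbolicPower_pointsIdeal (genericVec_ne_zero K 3 n) m

theorem forGeneralPoints_alpha_eq (m : ℕ) : ForGeneralPoints (fun p : Fin n → Pt K 3 =>
    alpha (symbolicPower (pointsIdeal p) m) = genericAlpha K n m) := by
  -- Only the finitely many degrees below the generic value need to be excluded, so a product of
  -- hypersurface equations suffices; the generic value itself is reached at every tuple.
  have h1 : ∀ t : Fin (genericAlpha K n m), ∃ D : MvPolynomial (Fin n × Fin 4) K, D ≠ 0 ∧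
      ∀ v : Fin n → Fin 4 → K, eval (fun p => v p.1 p.2) D ≠ 0 → ¬ HasForm t (fun _ => m) v := by
    intro t
    have h2 : ¬ HasForm t (fun _ => m)
        fun i j => (X (i, j) : MvPolynomial (Fin n × Fin 4) K) := fun h =>
      not_hasForm_of_lt_genericAlpha K n t.2
        (h.map (φ := algebraMap _ (GenericField K 3 n)) (IsFractionRing.injective _ _))
    obtain ⟨D, hD, hD'⟩ := exists_hypersurface_of_not_hasForm h2
    refine ⟨D, hD, fun v hv => ?_⟩
    have h3 := hD' K (eval fun p => v p.1 p.2) hv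
    convert h3 using 3 with i
    funext j
    simp
  choose D hD hD' using h1
  refine ⟨∏ t, D t, Finset.prod_ne_zero_iff.2 fun t _ => hD t, fun v hv hP => ?_⟩
  rw [map_prod, Finset.prod_ne_zero_iff] at hP
  rw [alpha_symbolicPower_pointsIdeal hv]
  apply le_antisymm
  · exact Nat.sInf_le ((hasForm_genericAlpha K n m).of_generic v)
  · refine le_csInf ⟨_, (hasForm_genericAlpha K n m).of_generic v⟩ fun t ht => ?_
    by_contra hlt
    push Not at hlt
    exact hD' ⟨t, hlt⟩ v (hP _ (Finset.mem_univ _)) ht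

theorem table_le_genericAlpha {β : ℚ} (hβ : b n = some β) {m : ℕ} (hm : 0 < m) :
    (β : ℝ) * m ≤ genericAlpha K n m := by
  have h1 : EffectiveM K (genericAlpha K n m) (n • {(m : ℤ)}) := by
    rw [effectiveM_iff (map_univ_const (n := n) (m : ℤ))]
    exact fun v => ⟨_, rfl, by simpa using (hasForm_genericAlpha K n m).of_generic v⟩
  have h2 := h1.table_le hβ (by exact_mod_cast hm)
  exact_mod_cast h2

end Generic

end FatPoints

end

theorem proposition2p4 {K : Type*} [Field K] [CharZero K] (n : ℕ) (β : ℚ)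
    (hβ : FatPoints.b n = some β) :
    ∃ g : ℝ, FatPoints.IsGeneralWaldschmidtConstant K 3 n g ∧
      FatPoints.HasWaldschmidtConstant
        (FatPoints.pointsIdeal (FatPoints.genericPoints K 3 n)) g ∧
      (β : ℝ) ≤ g := by
  have : Infinite K := CharZero.infinite K
  have hsub : Subadditive fun m => (FatPoints.genericAlpha K n m : ℝ) :=
    FatPoints.subadditive_genericAlpha
  -- Fekete's lemma, with lower bound 0 for the quotients.
  have hlim := hsub.tendsto_lim ⟨0, by rintro _ ⟨m, rfl⟩; positivity⟩
  refine ⟨hsub.lim, ⟨FatPoints.genericAlpha K n, FatPoints.forGeneralPoints_alpha_eq, hlim⟩,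
    ?_, ?_⟩
  · simpa only [FatPoints.HasWaldschmidtConstant, FatPoints.alpha_genericPoints] using hlim
  · refine ge_of_tendsto hlim (Filter.eventually_atTop.2 ⟨1, fun m hm => ?_⟩)
    rw [le_div_iff₀ (by exact_mod_cast hm)]
    exact FatPoints.table_le_genericAlpha hβ hm
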